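/- **Setting.** For every security parameter $\kappa$ fix a prime $q$ with $\kappa=\lfloor\log_2 q\rfloor$ (for $\kappa\ge 1$). $\mathrm{Setup}(1^\kappa)$ samples, from an arbitrary fixed distribution, a cyclic group $\mathbb G$ of order $q$ with a generator $g$ (descriptions and encoded elements have length polynomial in $\kappa$), and then an independent uniform generator $h$ of $\mathbb G$; $\mathrm{Com}(m,r)=g^mh^r$ is the Pedersen commitment, $m,r\in\mathbb Z_q$. The numbers $n$ of clients, $K\ge1$ of provers and $n_b\ge1$ of private bits per prover are polynomially bounded in $\kappa$. "Polynomial time" means non-uniform probabilistic polynomial time: families of circuits of polynomial size, with polynomially many random bits and random elements of $\mathbb Z_q$, whose gates are Boolean gates, arithmetic of $\mathbb Z_q$, operations of $\mathbb G$, and conversions between these and bit strings. The discrete-log advantage $\mathrm{Adv}^{\mathrm{DL}}_B(\kappa)$ of $B$ is the probability that $B(g^x)=x$ for a group sampled as above and uniform $x\in\mathbb Z_q$. **Functionality.** On inputs $X_1,\dots,X_K\in\mathbb Z_q$, $\mathcal M_{\mathrm{Bin}}$ samples independent $\Delta_k\sim\mathrm{Binomial}(n_b,1/2)$, outputs $y=\sum_k(X_k+\Delta_k)\in\mathbb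 Z_q$ publicly and $\Delta_k$ (mod $q$) to prover $k$. For $x\in\mathbb Z_q^n$ with additive shares $\sum_k [x_i]_k=x_i$, $\mathcal M_{\mathrm{Bin}}(x)$ denotes it on $X_k=\sum_{i:\,x_i\in\{0,1\}}[x_i]_k$. **Protocol $\Pi_{\mathrm{Bin}}$** (rounds run in parallel for all provers). *Oracles:* the bit-proof oracle $\mathcal O_{\mathrm{OR}}$, given $c$ from the verifier and an opening $(v,s)$ from the other party, answers whether $v\in\{0,1\}$ and $c=\mathrm{Com}(v,s)$; $\mathcal O_{\mathrm{morra}}$ returns uniform public bits. 1. Client $i$ publishes $c_{i,k}=\mathrm{Com}([x_i]_k,r_{i,k})$ with uniform $r_{i,k}$ for all $k$ and sends $([x_i]_k,r_{i,k})$ to prover $k$; client $i$ is valid if $\mathcal O_{\mathrm{OR}}$ accepts $\prod_kc_{i,k}$ with the opening $(x_i,\sum_kr_{i,k})$. Only valid clients are used below. 2. Prover $k$ samples uniform $v_{j,k}\in\{0,1\}$, $s_{j,k}\in\mathbb Z_q$ ($j\le n_b$) and publishes $c'_{j,k}=\mathrm{Com}(v_{j,k},s_{j,k})$. The verifier aborts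 (rejects) unless $\mathcal O_{\mathrm{OR}}$ accepts all of them. 3. $\mathcal O_{\mathrm{morra}}$ returns bits $b_{j,k}$. Put $\hat v_{j,k}=1-v_{j,k}$, $\hat s_{j,k}=-s_{j,k}$, $\hat c'_{j,k}=\mathrm{Com}(1,0)\,c_{j,k}'^{-1}$ if $b_{j,k}=1$, and $\hat v_{j,k}=v_{j,k}$, $\hat s_{j,k}=s_{j,k}$, $\hat c'_{j,k}=c'_{j,k}$ otherwise. 4. Prover $k$ sends $y_k=\sum_i[x_i]_k+\sum_j\hat v_{j,k}$ and $z_k=\sum_ir_{i,k}+\sum_j\hat s_{j,k}$. The verifier accepts if $\prod_ic_{i,k}\prod_j\hat c'_{j,k}=\mathrm{Com}(y_k,z_k)$ for all $k$. The published output is $y=\sum_ky_k$. **Theorem.** *Completeness.* For all $\kappa$, all $x\in\mathbb Z_q^n$ and all additive shares of $x$, when all parties are honest the verifier rejects with probability $0$, and $y$ is distributed exactly as the public output of $\mathcal M_{\mathrm{Bin}}(x)$. *Computational soundness.* Let a polynomial-time adversary $A$ with auxiliary input of polynomial length control the provers in an arbitrary set $I\subseteq[K]$ against an honest verifier; in each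 round it sees the public messages of the honest parties before it sends those of the corrupted provers. Let $x\in\mathbb Z_q^n$ (possibly depending on $\kappa$), with any additive shares. Call $y^*=\sum_{i:\,x_i\in\{0,1\}}x_i+\sum_{k,j}(v_{j,k}\oplus b_{j,k})$ the correct output, where for $k\in I$ the bit $v_{j,k}$ is the one with which $A$ opened its commitment to $\mathcal O_{\mathrm{OR}}$ (a value other than $1$ being read as $0$). Then (a) $y^*$ is distributed exactly as the public output of $\mathcal M_{\mathrm{Bin}}(x)$ and is independent of whether the verifier aborts before the public coins are tossed; (b) there is a polynomial-time $B$ with $$\Pr[\text{the verifier accepts and } y\ne y^*]\le \mathrm{Adv}^{\mathrm{DL}}_B(\kappa)\qquad\text{for all }\kappa;$$ (c) hence, if discrete logarithms are hard (every polynomial-time $B$ has negligible advantage), this probability is negligible. *Computational zero-knowledge.* Let a polynomial-time adversary control the verifier and the provers in a proper subset $I\subsetneq[K]$. It may submit arbitrary commitments to $\mathcal O_{\mathrm{OR}}$ in place of those of the honest provers, and may go on to $\mathcal O_{\mathrm{morra}}$ and the final message with any subset of the honest provers. The clients share their inputs with uniformly random additive shares. Then there is a polynomial-time simulator $\mathrm{Sim}$,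 depending only on the adversary and $I$, such that for all auxiliary inputs and all client inputs $x\in\mathbb Z_q^n$ with at least one $x_i\in\{0,1\}$ (not needed if only one prover is honest) the following two ensembles are computationally indistinguishable, where the start of the view consists of the public parameters, the adversary's coins and auxiliary input, the shares and commitment randomness of the corrupted provers, all $c_{i,k}$, and the set of valid clients: - the start of the view, the messages that the adversary receives from honest provers and oracles in $\Pi_{\mathrm{Bin}}$, and the noise values $\sum_j\hat v_{j,k}$ mod $q$ of the honest provers $k\notin I$ (defined by the coins $b_{j,k}$ also where the adversary stops before they are revealed); - the start of the view, the output of $\mathrm{Sim}$, and the noise values $\Delta_k$, $k\notin I$, of $\mathcal M_{\mathrm{Bin}}$; here $\mathrm{Sim}$ is given the start of the view, chooses the inputs $X_k$, $k\in I$, to $\mathcal M_{\mathrm{Bin}}$ (the honest provers' inputs being those of $\mathcal M_{\mathrm{Bin}}(x)$), and receives $y$ and $\Delta_k$, $k\in I$. For $K=1$ (so $I=\emptyset$) this is zero-knowledge of the single-curator protocol against a corrupted verifier. -/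

import Mathlib

open scoped BigOperators

/-! ### Negligible functions and polynomial bounds -/

/-- `f` is bounded by a polynomial in the security parameter. -/
def PolyBounded (f : ℕ → ℕ) : Prop :=
  ∃ p : Polynomial ℕ, ∀ κ, f κ ≤ p.eval κ

/-- `f` decays faster than the inverse of every polynomial. -/
def Negligible (f : ℕ → ℝ) : Prop :=
  Asymptotics.SuperpolynomialDecay Filter.atTop (fun κ : ℕ => (κ : ℝ)) f

/-! ### Prime order groups and their generation -/

/-- A cyclic group of order `q` with a distinguished generator, an injective encoding of its
elements (as natural numbers, i.e. as bit strings) and a bit string describing the group. -/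
structure PrimeGroup (q : ℕ) where
  carrier : Type
  [commGroup : CommGroup carrier]
  card_eq : Nat.card carrier = q
  gen : carrier
  gen_generates : ∀ a : carrier, a ∈ Subgroup.zpowers gen
  enc : carrier → ℕ
  enc_injective : Function.Injective enc
  descr : List Bool

attribute [instance] PrimeGroup.commGroup

/-- The group element encoded by `m`, and `1` if `m` encodes no element. -/
noncomputable def PrimeGroup.dec {q : ℕ} (P : PrimeGroup q) (m : ℕ) : P.carrier :=
  open Classical in if hm : ∃ a, P.enc a = m then hm.choose else 1

/-- A group generation algorithm. For the security parameter `κ` a prime `q κ` with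
`κ = ⌊log₂ (q κ)⌋` is fixed (`κ = 0` is no such logarithm), and a group of order `q κ`, with a
generator, is sampled. Descriptions and encoded elements have polynomial length. -/
structure GroupGen where
  q : ℕ → ℕ
  prime : ∀ κ, (q κ).Prime
  log_q : ∀ κ, 1 ≤ κ → Nat.log 2 (q κ) = κ
  Seed : ℕ → Type
  law : ∀ κ, PMF (Seed κ)
  grp : ∀ κ, Seed κ → PrimeGroup (q κ)
  enc_poly : ∃ p : Polynomial ℕ, ∀ κ ω a, (grp κ ω).enc a < 2 ^ p.eval κ
  descr_poly : ∃ p : Polynomial ℕ, ∀ κ ω, (grp κ ω).descr.length ≤ p.eval κ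

instance (S : GroupGen) (κ : ℕ) : Fact (S.q κ).Prime := ⟨S.prime κ⟩

/-! ### The machine model: circuits over bits, `ℤ_q` and the group -/

/-- The types of wires. -/
inductive Ty : Type
  | bit : Ty
  | fld : Ty
  | grp : Ty
  | prod : Ty → Ty → Ty
  | pow : Ty → ℕ → Ty

/-- The values that a wire can carry. -/
@[reducible] def Ty.El {q : ℕ} (P : PrimeGroup q) : Ty → Type
  | .bit => Bool
  | .fld => ZMod q
  | .grp => P.carrier
  | .prod a b => a.El P × b.El P
  | .pow a n => Fin n → a.El P

/-- Circuits with inputs of type `a` and outputs of type `b`. The syntax does not depend on the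
group, so that one circuit works for all groups that may be sampled. -/
inductive Circ : Ty → Ty → Type
  | id (a : Ty) : Circ a a
  | comp {a b c : Ty} (f : Circ a b) (g : Circ b c) : Circ a c
  | pair {a b c : Ty} (f : Circ a b) (g : Circ a c) : Circ a (.prod b c)
  | fst (a b : Ty) : Circ (.prod a b) a
  | snd (a b : Ty) : Circ (.prod a b) b
  | tup {a b : Ty} {n : ℕ} (f : Fin n → Circ a b) : Circ a (.pow b n)
  | proj (a : Ty) {n : ℕ} (i : Fin n) : Circ (.pow a n) a
  | bconst (a : Ty) (c : Bool) : Circ a .bit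
  | band : Circ (.prod .bit .bit) .bit
  | bnot : Circ .bit .bit
  | fconst (a : Ty) (c : ℤ) : Circ a .fld
  | fadd : Circ (.prod .fld .fld) .fld
  | fmul : Circ (.prod .fld .fld) .fld
  | finv : Circ .fld .fld
  | feq : Circ (.prod .fld .fld) .bit
  | fbit (i : ℕ) : Circ .fld .bit
  | fofbit : Circ .bit .fld
  | ggen (a : Ty) : Circ a .grp
  | gmul : Circ (.prod .grp .grp) .grp
  | gpow : Circ (.prod .grp .fld) .grp
  | geq : Circ (.prod .grp .grp) .bit
  | gbit (i : ℕ) : Circ .grp .bit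
  | gdec (m : ℕ) : Circ (.pow .bit m) .grp
  | gdescr (a : Ty) (i : ℕ) : Circ a .bit

/-- The function that a circuit computes. -/
noncomputable def Circ.eval {q : ℕ} (P : PrimeGroup q) :
    {a b : Ty} → Circ a b → a.El P → b.El P
  | _, _, .id _, u => u
  | _, _, .comp f g, u => g.eval P (f.eval P u)
  | _, _, .pair f g, u => (f.eval P u, g.eval P u)
  | _, _, .fst _ _, u => u.1
  | _, _, .snd _ _, u => u.2
  | _, _, .tup f, u => fun i => (f i).eval P u
  | _, _, .proj _ i, u => u i
  | _, _, .bconst _ c, _ => c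
  | _, _, .band, u => u.1 && u.2
  | _, _, .bnot, u => !u
  | _, _, .fconst _ c, _ => (c : ZMod q)
  | _, _, .fadd, u => u.1 + u.2
  | _, _, .fmul, u => u.1 * u.2
  | _, _, .finv, u => Inv.inv (α := ZMod q) u
  | _, _, .feq, u => decide (u.1 = u.2)
  | _, _, .fbit i, u => Nat.testBit (ZMod.val (n := q) u) i
  | _, _, .fofbit, u => if u = true then 1 else 0
  | _, _, .ggen _, _ => P.gen
  | _, _, .gmul, u => u.1 * u.2
  | _, _, .gpow, u => u.1 ^ ZMod.val (n := q) u.2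
  | _, _, .geq, u => open Classical in decide (u.1 = u.2)
  | _, _, .gbit i, u => Nat.testBit (P.enc u) i
  | _, _, .gdec m, u => P.dec (Nat.ofBits (n := m) u)
  | _, _, .gdescr _ i, _ => P.descr.getD i false

/-- The number of gates of a circuit (tupling and wiring count too; decoding a group element
from `m` bits counts `m + 1`). -/
def Circ.size : {a b : Ty} → Circ a b → ℕ
  | _, _, .comp f g => f.size + g.size
  | _, _, .pair f g => f.size + g.size + 1
  | _, _, .tup f => (∑ i, (f i).size) + 1
  | _, _, .gdec m => m + 1
  | _, _, _ => 1

/-- A random tape: `m` uniform bits and `m` uniform elements of `ℤ_q`. -/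
@[reducible] def Ty.tape (m : ℕ) : Ty := .prod (.pow .bit m) (.pow .fld m)

/-! ### Pedersen commitments, public parameters, discrete logarithms -/

section Pedersen

variable {q : ℕ} (P : PrimeGroup q) (h : P.carrier)

/-- The Pedersen commitment to `m` with randomness `r`. -/
def com (m r : ZMod q) : P.carrier := P.gen ^ m.val * h ^ r.val

/-- The ideal functionality for bit proofs: the verifier submits the commitment `c`, the other
party the opening `(v, s)`. -/
noncomputable def orOracle (c : P.carrier) (v s : ZMod q) : Bool :=
  open Classical in decide ((v = 0 ∨ v = 1) ∧ c = com P h v s)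

end Pedersen

/-- Public parameters: the seed of the group, and the exponent `x ≠ 0` for which `h = g ^ x`.
No party is ever given `x`. -/
abbrev GroupGen.PP (S : GroupGen) (κ : ℕ) : Type := S.Seed κ × (ZMod (S.q κ))ˣ

/-- `Setup`: a sampled group with generator `g`, and an independent uniform generator `h`. -/
noncomputable def GroupGen.setup (S : GroupGen) (κ : ℕ) : PMF (S.PP κ) :=
  (S.law κ).bind fun ω => (PMF.uniformOfFintype (ZMod (S.q κ))ˣ).map fun x => (ω, x)

/-- The group that belongs to the public parameters. -/
abbrev GroupGen.gp (S : GroupGen) {κ : ℕ} (pp : S.PP κ) : PrimeGroup (S.q κ) := S.grp κ pp.1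

/-- The second generator of the public parameters. -/
def GroupGen.h (S : GroupGen) {κ : ℕ} (pp : S.PP κ) : (S.gp pp).carrier :=
  (S.gp pp).gen ^ (pp.2 : ZMod (S.q κ)).val

/-- A (non-uniform, probabilistic) polynomial time adversary in the discrete logarithm game. -/
structure DLAdversary where
  coins : ℕ → ℕ
  solve : ∀ κ, Circ (.prod (.tape (coins κ)) .grp) .fld
  coins_poly : PolyBounded coins
  solve_poly : PolyBounded fun κ => (solve κ).size

/-- The discrete logarithm game: `x` is uniform in `ℤ_q`, the adversary is given `g ^ x`. -/
noncomputable def dlGame (S : GroupGen) (B : DLAdversary) (κ : ℕ) : PMF Bool :=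
  (S.law κ).bind fun ω =>
    (PMF.uniformOfFintype (ZMod (S.q κ) ×
      ((Fin (B.coins κ) → Bool) × (Fin (B.coins κ) → ZMod (S.q κ))))).map fun w =>
        decide ((B.solve κ).eval (S.grp κ ω) (w.2, (S.grp κ ω).gen ^ w.1.val) = w.1)

/-- The advantage in the discrete logarithm game. -/
noncomputable def dlAdv (S : GroupGen) (B : DLAdversary) (κ : ℕ) : ENNReal :=
  dlGame S B κ true

/-- The discrete logarithm assumption. -/
def DLHard (S : GroupGen) : Prop :=
  ∀ B : DLAdversary, Negligible fun κ => (dlAdv S B κ).toReal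

/-! ### Computational indistinguishability -/

/-- A distinguisher for values of type `τ κ`. -/
structure Distinguisher (τ : ℕ → Ty) where
  coins : ℕ → ℕ
  guess : ∀ κ, Circ (.prod (.tape (coins κ)) (τ κ)) .bit
  coins_poly : PolyBounded coins
  guess_poly : PolyBounded fun κ => (guess κ).size

/-- The output of a distinguisher on a value drawn from `U`, for public parameters that are
drawn by `Setup`. -/
noncomputable def distGame (S : GroupGen) {τ : ℕ → Ty} (E : Distinguisher τ) (κ : ℕ)
    (U : ∀ pp : S.PP κ, PMF ((τ κ).El (S.gp pp))) : PMF Bool :=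
  (S.setup κ).bind fun pp => (U pp).bind fun u =>
    (PMF.uniformOfFintype
      ((Fin (E.coins κ) → Bool) × (Fin (E.coins κ) → ZMod (S.q κ)))).map fun t =>
        (E.guess κ).eval (S.gp pp) (t, u)

/-- Computational indistinguishability of two ensembles. -/
def CompIndist (S : GroupGen) (τ : ℕ → Ty)
    (U V : ∀ κ, ∀ pp : S.PP κ, PMF ((τ κ).El (S.gp pp))) : Prop :=
  ∀ E : Distinguisher τ, Negligible fun κ =>
    |(distGame S E κ (U κ) true).toReal - (distGame S E κ (V κ) true).toReal|

/-! ### The ideal functionality -/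

/-- The binomial distribution with parameters `n` and `1/2`. -/
noncomputable def binomialHalf (n : ℕ) : PMF (Fin (n + 1)) :=
  PMF.ofFintype (fun i => (n.choose i : ENNReal) / 2 ^ n) (by
    have h : ∑ i : Fin (n + 1), (n.choose i : ENNReal) = 2 ^ n := by
      rw [Fin.sum_univ_eq_sum_range (fun i => (n.choose i : ENNReal)) (n + 1)]
      exact_mod_cast Nat.sum_range_choose n
    simp only [div_eq_mul_inv]
    rw [← Finset.sum_mul, h]
    exact ENNReal.mul_inv_cancel (by simp) (by simp))

/-- `K` independent samples of the binomial distribution with parameters `nb` and `1/2`. -/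
noncomputable def noise (nb : ℕ) : (K : ℕ) → PMF (Fin K → ℕ)
  | 0 => PMF.pure Fin.elim0
  | K + 1 => (binomialHalf nb).bind fun a => (noise nb K).map fun f =>
      Fin.cons (α := fun _ => ℕ) (a : ℕ) f

/-- The functionality `M_Bin` on the provers' inputs `X`: the public output `y` and the noise
values that are handed to the provers. -/
noncomputable def mBin {q : ℕ} (nb : ℕ) {K : ℕ} (X : Fin K → ZMod q) :
    PMF (ZMod q × (Fin K → ZMod q)) :=
  (noise nb K).map fun Δ => (∑ k, (X k + (Δ k : ZMod q)), fun k => (Δ k : ZMod q))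

/-! ### The protocol -/

section Protocol

variable {q : ℕ} (P : PrimeGroup q) (h : P.carrier) {n nb K : ℕ}

/-- A bit as an element of `ℤ_q`. -/
def bitVal (v : Bool) : ZMod q := if v then 1 else 0

/-- The clients whose inputs are bits. -/
def legal (x : Fin n → ZMod q) : Finset (Fin n) :=
  Finset.univ.filter fun i => x i = 0 ∨ x i = 1

/-- The commitments to the shares, published by the clients (`sh k i` is the share of client `i`
for prover `k`, and `r k i` the randomness of the commitment). -/
def clientCom (sh r : Fin K → Fin n → ZMod q) (k : Fin K) (i : Fin n) : P.carrier :=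
  com P h (sh k i) (r k i)

/-- The public outcome of the validation of client `i`: the bit proof oracle is applied to the
derived commitment and to the opening that the client provides. -/
noncomputable def valid (x : Fin n → ZMod q) (sh r : Fin K → Fin n → ZMod q) (i : Fin n) : Bool :=
  orOracle P h (∏ k, clientCom P h sh r k i) (x i) (∑ k, r k i)

/-- The final message `(y_k, z_k)` of an honest prover, with validated clients `va`, shares `sh`,
their randomness `r`, private bits `v`, their randomness `s` and public bits `b`. -/
def response (va : Fin n → Bool) (sh r : Fin n → ZMod q) (v : Fin nb → Bool)
    (s : Fin nb → ZMod q) (b : Fin nb → Bool) : ZMod q × ZMod q :=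
  (∑ i with va i = true, sh i + ∑ j, (if b j then 1 - bitVal (v j) else bitVal (v j)),
    ∑ i with va i = true, r i + ∑ j, (if b j then - s j else s j))

/-- The verifier's final check of the message `yz` of one prover, with the client commitments `c`
and the commitments `c'` to the private bits of this prover. -/
noncomputable def check (va : Fin n → Bool) (c : Fin n → P.carrier) (c' : Fin nb → P.carrier)
    (b : Fin nb → Bool) (yz : ZMod q × ZMod q) : Bool :=
  open Classical in decide
    ((∏ i with va i = true, c i) * (∏ j, (if b j then com P h 1 0 * (c' j)⁻¹ else c' j)) =
      com P h yz.1 yz.2)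

/-- The randomness of the clients (`r`), of the honest provers (`v` and `s`), and of the public
coin oracle (`b`). -/
abbrev PartyRand (q n nb K : ℕ) : Type :=
  (Fin K → Fin n → ZMod q) × (Fin K → Fin nb → Bool) × (Fin K → Fin nb → ZMod q) ×
    (Fin K → Fin nb → Bool)

/-- What the verifier decides, and the published noisy count. -/
structure Outcome (q : ℕ) where
  accept : Bool
  y : ZMod q

/-- The execution of the protocol by honest parties. -/
noncomputable def honestOutcome (x : Fin n → ZMod q) (sh : Fin K → Fin n → ZMod q)
    (w : PartyRand q n nb K) : Outcome q :=
  let r := w.1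
  let v := w.2.1
  let s := w.2.2.1
  let b := w.2.2.2
  let va := valid P h x sh r
  let c' := fun k j => com P h (bitVal (v k j)) (s k j)
  let resp := fun k => response va (sh k) (r k) (v k) (s k) (b k)
  { accept :=
      decide (∀ k j, orOracle P h (c' k j) (bitVal (v k j)) (s k j) = true) &&
      decide (∀ k, check P h va (clientCom P h sh r k) (c' k) (b k) (resp k) = true)
    y := ∑ k, (resp k).1 }

/-! ### Corrupted parties -/

/-- The type of what the adversary sees at first: its coins, its auxiliary input, `h`, the shares
and commitment randomness of the corrupted provers, the client commitments, and which clients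
are valid. -/
@[reducible] def Ty.start (n K m l : ℕ) : Ty :=
  .prod (.tape m) (.prod (.pow .bit l) (.prod .grp
    (.prod (.pow (.pow (.prod .fld .fld) n) K)
      (.prod (.pow (.pow .grp n) K) (.pow .bit n)))))

/-- The initial view. Entries for provers outside of `I` are blanked. -/
noncomputable def startView {m l : ℕ} (I : Finset (Fin K)) (aux : Fin l → Bool)
    (x : Fin n → ZMod q) (sh r : Fin K → Fin n → ZMod q)
    (ρ : (Fin m → Bool) × (Fin m → ZMod q)) : (Ty.start n K m l).El P :=
  (ρ, aux, h, fun k i => if k ∈ I then (sh k i, r k i) else (0, 0),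
    clientCom P h sh r, valid P h x sh r)

/-- The commitments of the honest provers to their private bits; blanked for `k ∈ I`. -/
def honestComs (I : Finset (Fin K)) (v : Fin K → Fin nb → Bool) (s : Fin K → Fin nb → ZMod q)
    (k : Fin K) (j : Fin nb) : P.carrier :=
  if k ∈ I then 1 else com P h (bitVal (v k j)) (s k j)

/-- An adversary that controls provers, for one value of the security parameter. It sees
the messages of the honest provers in each round before it chooses those of the corrupted
provers. First come the commitments to private bits, with the openings for the bit
proof oracle; then, given the public coins, the final messages. -/
structure ProverAttack (n nb K m l : ℕ) where
  commit : Circ (.prod (.start n K m l) (.pow (.pow .grp nb) K))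
    (.pow (.pow (.prod .grp (.prod .fld .fld)) nb) K)
  respond : Circ (.prod (.prod (.start n K m l) (.pow (.pow .grp nb) K))
      (.prod (.pow (.pow .bit nb) K) (.pow (.prod .fld .fld) K)))
    (.pow (.prod .fld .fld) K)

/-- The outcome of an execution with corrupted provers and an honest verifier. -/
structure AttackOutcome (q : ℕ) where
  /-- the verifier did not abort before the public coins were tossed -/
  started : Bool
  /-- the decision of the verifier -/
  accept : Bool
  /-- the published value -/
  y : ZMod q
  /-- the correct value: the count of the clients' actual inputs, plus, for every prover, the sum
  of the exclusive ors of its committed bits with its public coins -/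
  ideal : ZMod q

/-- Execution with the provers in `I` corrupted. -/
noncomputable def attackOutcome {m l : ℕ} (A : ProverAttack n nb K m l) (I : Finset (Fin K))
    (aux : Fin l → Bool) (x : Fin n → ZMod q) (sh : Fin K → Fin n → ZMod q)
    (w : ((Fin m → Bool) × (Fin m → ZMod q)) × PartyRand q n nb K) : AttackOutcome q :=
  let r := w.2.1
  let v := w.2.2.1
  let s := w.2.2.2.1
  let b := w.2.2.2.2
  let va := valid P h x sh r
  let view := (startView P h I aux x sh r w.1, honestComs P h I v s)
  let a := A.commit.eval P view
  let c' := fun k j => if k ∈ I then (a k j).1 else com P h (bitVal (v k j)) (s k j)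
  let op := fun k j => if k ∈ I then (a k j).2 else (bitVal (v k j), s k j)
  let hresp := fun k => response va (sh k) (r k) (v k) (s k) (b k)
  let aresp := A.respond.eval P (view, b, fun k => if k ∈ I then (0, 0) else hresp k)
  let resp := fun k => if k ∈ I then aresp k else hresp k
  let started := decide (∀ k j, orOracle P h (c' k j) (op k j).1 (op k j).2 = true)
  { started := started
    accept := started &&
      decide (∀ k, check P h va (clientCom P h sh r k) (c' k) (b k) (resp k) = true)
    y := ∑ k, (resp k).1
    ideal := ∑ i ∈ legal x, x i +
      ∑ k, ∑ j, bitVal (xor (decide ((op k j).1 = 1)) (b k j)) }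

/-- A corrupted verifier that colludes with corrupted provers, for one value of the security
parameter. For every honest prover it chooses the commitments that it submits to the bit proof
oracle; given the answers, it chooses the honest provers with which it goes on to the public coin
oracle. -/
structure VerifierAttack (n nb K m l : ℕ) where
  submit : Circ (.prod (.start n K m l) (.pow (.pow .grp nb) K)) (.pow (.pow .grp nb) K)
  proceed : Circ (.prod (.prod (.start n K m l) (.pow (.pow .grp nb) K)) (.pow (.pow .bit nb) K))
    (.pow .bit K)

/-- The type of what is received after the start: the honest commitments, the answers of the
bit proof oracle, the public coins, and the final messages of the honest provers. -/
@[reducible] def Ty.received (nb K : ℕ) : Ty :=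
  .prod (.pow (.pow .grp nb) K) (.prod (.pow (.pow .bit nb) K)
    (.prod (.pow (.pow .bit nb) K) (.pow (.prod .fld .fld) K)))

/-- The type of a full view together with the noise values of the honest provers. -/
@[reducible] def Ty.joint (n nb K m l : ℕ) : Ty :=
  .prod (.prod (.start n K m l) (.received nb K)) (.pow .fld K)

/-- The view of a corrupted verifier and corrupted provers, jointly with the noise values of the
honest provers. Entries that the adversary does not receive are blanked. -/
noncomputable def realJoint {m l : ℕ} (A : VerifierAttack n nb K m l) (I : Finset (Fin K))
    (aux : Fin l → Bool) (x : Fin n → ZMod q) (sh : Fin K → Fin n → ZMod q)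
    (w : ((Fin m → Bool) × (Fin m → ZMod q)) × PartyRand q n nb K) : (Ty.joint n nb K m l).El P :=
  let r := w.2.1
  let v := w.2.2.1
  let s := w.2.2.2.1
  let b := w.2.2.2.2
  let va := valid P h x sh r
  let start := startView P h I aux x sh r w.1
  let c' := honestComs P h I v s
  let st := A.submit.eval P (start, c')
  let ans := fun k j =>
    if k ∈ I then false else orOracle P h (st k j) (bitVal (v k j)) (s k j)
  let go := A.proceed.eval P ((start, c'), ans)
  let coins := fun k j => if k ∈ I ∨ go k = true then b k j else false
  let resp := fun k => if k ∉ I ∧ go k = true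
    then response va (sh k) (r k) (v k) (s k) (b k) else (0, 0)
  ((start, c', ans, coins, resp),
    fun k => if k ∈ I then 0 else ∑ j, bitVal (xor (v k j) (b k j)))

/-- A simulator for one value of the security parameter, with `m'` coins. From the initial view it
computes the inputs of the corrupted provers to `M_Bin`; given `y` and the noise values of the
corrupted provers, it produces what is received after the start. -/
structure Simulation (n nb K m l m' : ℕ) where
  input : Circ (.prod (.tape m') (.start n K m l)) (.pow .fld K)
  output : Circ (.prod (.prod (.tape m') (.start n K m l)) (.prod .fld (.pow .fld K)))
    (.received nb K)

/-- The ideal counterpart of `realJoint`. The simulator is given the initial view, and of the output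
of `M_Bin` only `y` and the noise values of the corrupted provers. -/
noncomputable def idealJoint [NeZero q] {m l m' : ℕ} (Sim : Simulation n nb K m l m')
    (I : Finset (Fin K)) (aux : Fin l → Bool) (x : Fin n → ZMod q) (sh : Fin K → Fin n → ZMod q)
    (w : ((Fin m → Bool) × (Fin m → ZMod q)) × ((Fin m' → Bool) × (Fin m' → ZMod q)) ×
      (Fin K → Fin n → ZMod q)) : PMF ((Ty.joint n nb K m l).El P) :=
  let start := startView P h I aux x sh w.2.2 w.1
  let X := Sim.input.eval P (w.2.1, start)
  (mBin nb fun k => if k ∈ I then X k else ∑ i ∈ legal x, sh k i).map fun out =>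
    ((start, Sim.output.eval P ((w.2.1, start), out.1, fun k => if k ∈ I then out.2 k else 0)),
      fun k => if k ∈ I then 0 else out.2 k)

/-- Additive secret sharing: all shares but that of the first prover are the uniform values `t`. -/
def additiveShares (x : Fin n → ZMod q) (t : Fin K → Fin n → ZMod q) (k : Fin K) (i : Fin n) :
    ZMod q :=
  if k.val = 0 then x i - ∑ k' : Fin K with k'.val ≠ 0, t k' i else t k i

end Protocol

/-! ### Experiments, as functions of the security parameter -/

/-- Numbers of clients, of private bits per prover, and of provers. -/
structure Sizes where
  n : ℕ → ℕ
  nb : ℕ → ℕ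
  K : ℕ → ℕ
  n_poly : PolyBounded n
  nb_poly : PolyBounded nb
  K_poly : PolyBounded K
  nb_pos : ∀ κ, 1 ≤ nb κ
  K_pos : ∀ κ, 1 ≤ K κ

/-- A polynomial time adversary that controls provers. -/
structure ProverAdversary (N : Sizes) where
  coins : ℕ → ℕ
  auxLen : ℕ → ℕ
  alg : ∀ κ, ProverAttack (N.n κ) (N.nb κ) (N.K κ) (coins κ) (auxLen κ)
  coins_poly : PolyBounded coins
  auxLen_poly : PolyBounded auxLen
  commit_poly : PolyBounded fun κ => (alg κ).commit.size
  respond_poly : PolyBounded fun κ => (alg κ).respond.size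

/-- A polynomial time adversary that controls the verifier and provers. -/
structure VerifierAdversary (N : Sizes) where
  coins : ℕ → ℕ
  auxLen : ℕ → ℕ
  alg : ∀ κ, VerifierAttack (N.n κ) (N.nb κ) (N.K κ) (coins κ) (auxLen κ)
  coins_poly : PolyBounded coins
  auxLen_poly : PolyBounded auxLen
  submit_poly : PolyBounded fun κ => (alg κ).submit.size
  proceed_poly : PolyBounded fun κ => (alg κ).proceed.size

/-- A polynomial time simulator for the adversary `A`. -/
structure Simulator {N : Sizes} (A : VerifierAdversary N) where
  coins : ℕ → ℕ
  alg : ∀ κ, Simulation (N.n κ) (N.nb κ) (N.K κ) (A.coins κ) (A.auxLen κ) (coins κ)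
  coins_poly : PolyBounded coins
  input_poly : PolyBounded fun κ => (alg κ).input.size
  output_poly : PolyBounded fun κ => (alg κ).output.size

/-- The honest execution, with `Setup`. -/
noncomputable def honestExp (S : GroupGen) (N : Sizes) (κ : ℕ) (x : Fin (N.n κ) → ZMod (S.q κ))
    (sh : Fin (N.K κ) → Fin (N.n κ) → ZMod (S.q κ)) : PMF (Outcome (S.q κ)) :=
  (S.setup κ).bind fun pp =>
    (PMF.uniformOfFintype (PartyRand (S.q κ) (N.n κ) (N.nb κ) (N.K κ))).map fun w =>
      honestOutcome (S.gp pp) (S.h pp) x sh w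

/-- The execution with corrupted provers, with `Setup`. -/
noncomputable def attackExp (S : GroupGen) {N : Sizes} (A : ProverAdversary N) (κ : ℕ)
    (I : Finset (Fin (N.K κ))) (aux : Fin (A.auxLen κ) → Bool) (x : Fin (N.n κ) → ZMod (S.q κ))
    (sh : Fin (N.K κ) → Fin (N.n κ) → ZMod (S.q κ)) : PMF (AttackOutcome (S.q κ)) :=
  (S.setup κ).bind fun pp =>
    (PMF.uniformOfFintype (((Fin (A.coins κ) → Bool) × (Fin (A.coins κ) → ZMod (S.q κ))) ×
      PartyRand (S.q κ) (N.n κ) (N.nb κ) (N.K κ))).map fun w =>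
        attackOutcome (S.gp pp) (S.h pp) (A.alg κ) I aux x sh w

/-- The probability that the verifier accepts although the published value is wrong. -/
noncomputable def cheatProb (S : GroupGen) {N : Sizes} (A : ProverAdversary N) (κ : ℕ)
    (I : Finset (Fin (N.K κ))) (aux : Fin (A.auxLen κ) → Bool) (x : Fin (N.n κ) → ZMod (S.q κ))
    (sh : Fin (N.K κ) → Fin (N.n κ) → ZMod (S.q κ)) : ENNReal :=
  (attackExp S A κ I aux x sh).map (fun o => o.accept && decide (o.y ≠ o.ideal)) true

/-- The real view, jointly with the noise of the honest provers, for given public parameters;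
the clients' shares are random. -/
noncomputable def realEnsemble (S : GroupGen) {N : Sizes} (A : VerifierAdversary N) (κ : ℕ)
    (I : Finset (Fin (N.K κ))) (aux : Fin (A.auxLen κ) → Bool) (x : Fin (N.n κ) → ZMod (S.q κ))
    (pp : S.PP κ) :
    PMF ((Ty.joint (N.n κ) (N.nb κ) (N.K κ) (A.coins κ) (A.auxLen κ)).El (S.gp pp)) :=
  (PMF.uniformOfFintype (Fin (N.K κ) → Fin (N.n κ) → ZMod (S.q κ))).bind fun t =>
    (PMF.uniformOfFintype (((Fin (A.coins κ) → Bool) × (Fin (A.coins κ) → ZMod (S.q κ))) ×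
      PartyRand (S.q κ) (N.n κ) (N.nb κ) (N.K κ))).map fun w =>
        realJoint (S.gp pp) (S.h pp) (A.alg κ) I aux x (additiveShares x t) w

/-- The simulated view, jointly with the noise that `M_Bin` hands to the honest provers. -/
noncomputable def idealEnsemble (S : GroupGen) {N : Sizes} (A : VerifierAdversary N)
    (Sim : Simulator A) (κ : ℕ) (I : Finset (Fin (N.K κ))) (aux : Fin (A.auxLen κ) → Bool)
    (x : Fin (N.n κ) → ZMod (S.q κ)) (pp : S.PP κ) :
    PMF ((Ty.joint (N.n κ) (N.nb κ) (N.K κ) (A.coins κ) (A.auxLen κ)).El (S.gp pp)) :=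
  (PMF.uniformOfFintype (Fin (N.K κ) → Fin (N.n κ) → ZMod (S.q κ))).bind fun t =>
    (PMF.uniformOfFintype (((Fin (A.coins κ) → Bool) × (Fin (A.coins κ) → ZMod (S.q κ))) ×
      ((Fin (Sim.coins κ) → Bool) × (Fin (Sim.coins κ) → ZMod (S.q κ))) ×
        (Fin (N.K κ) → Fin (N.n κ) → ZMod (S.q κ)))).bind fun w =>
          idealJoint (S.gp pp) (S.h pp) (Sim.alg κ) I aux x (additiveShares x t) w

/-!
Completeness and the first part of soundness hold since `com` is a homomorphism, and since the sum
modulo 2 of a private bit and an independent uniform public coin is again a uniform bit that is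
independent of the private one.

If the verifier accepts a wrong output, then for some corrupted prover the final message and the
openings that were given to the bit proof oracle are two openings with different values of one
commitment, and these determine the logarithm of `h`. The discrete logarithm game ranges over all
exponents and the protocol over nonzero ones only; the reduction wins at the exponent `0` by its
default answer, the quotient with denominator `0`.

Zero-knowledge is perfect. If the logarithm `a` of `h` is known, a commitment can be opened to every
value. Hence for each fixed sharing the protocol may be run with commitments whose product opens to
the partial count of the prover, which is how the simulator commits. There remains one difference:
the simulator uses uniform values in place of the partial counts of the honest provers but one, and
the public output for the last of them. The exchange of these values with the partial counts,
compensated by a change of the shares of a legal input (and of the commitment randomness, so that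
no client commitment changes), is an injection of the space of all random choices into itself, and
it maps the one experiment to the other.
-/

/-! ### Uniform distributions -/

section Uniform

variable {α β γ δ ε : Type*} [Fintype α] [Fintype β] [Fintype γ] [Fintype δ] [Nonempty α]
  [Nonempty β] [Nonempty γ] [Nonempty δ]

/-- The map `f` sends the uniform distribution on `α` to the uniform distribution on `β`: it turns
uniform randomness of one shape into uniform randomness of another shape. -/
def PreservesUniform (f : α → β) : Prop :=
  (PMF.uniformOfFintype α).map f = PMF.uniformOfFintype β

theorem uniform_map_apply [DecidableEq ε] (f : α → ε) (c : ε) :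
    (PMF.uniformOfFintype α).map f c =
      (Finset.univ.filter fun a => f a = c).card / (Fintype.card α : ENNReal) := by
  rw [PMF.map_apply, tsum_fintype]
  simp only [PMF.uniformOfFintype_apply, eq_comm (a := c)]
  rw [← Finset.sum_filter, Finset.sum_const, nsmul_eq_mul, div_eq_mul_inv]

theorem uniform_map_prod (f : α × β → ε) :
    (PMF.uniformOfFintype (α × β)).map f =
      (PMF.uniformOfFintype α).bind fun a => (PMF.uniformOfFintype β).map fun b => f (a, b) := by
  ext c
  simp only [PMF.bind_apply, PMF.map_apply, tsum_fintype, Fintype.sum_prod_type,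
    PMF.uniformOfFintype_apply, Fintype.card_prod, Nat.cast_mul, Finset.mul_sum, mul_ite, mul_zero]
  rw [ENNReal.mul_inv (by simp) (by simp)]

theorem preservesUniform_of_bijective {f : α → β} (hf : Function.Bijective f) :
    PreservesUniform f := by
  ext b
  obtain ⟨a, rfl⟩ := hf.2 b
  rw [PMF.map_apply, tsum_eq_single a fun a' ha => if_neg (hf.1.ne ha.symm), if_pos rfl,
    PMF.uniformOfFintype_apply, PMF.uniformOfFintype_apply, Fintype.card_of_bijective hf]

theorem preservesUniform_equiv (e : α ≃ β) : PreservesUniform e :=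
  preservesUniform_of_bijective e.bijective

theorem preservesUniform_id : PreservesUniform (id : α → α) := PMF.map_id _

theorem preservesUniform_uncurry {f : α → β → γ} (hf : ∀ a, PreservesUniform (f a)) :
    PreservesUniform fun u : α × β => f u.1 u.2 := by
  rw [PreservesUniform, uniform_map_prod]
  exact (congrArg _ (funext hf)).trans (PMF.bind_const _ _)

theorem preservesUniform_snd : PreservesUniform (Prod.snd : α × β → β) :=
  preservesUniform_uncurry fun _ => preservesUniform_id

namespace PreservesUniform

theorem map_comp {f : α → β} (hf : PreservesUniform f) (g : β → ε) :
    (PMF.uniformOfFintype α).map (fun a => g (f a)) = (PMF.uniformOfFintype β).map g := by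
  rw [← hf, PMF.map_comp]
  rfl

theorem comp {g : β → γ} {f : α → β} (hg : PreservesUniform g) (hf : PreservesUniform f) :
    PreservesUniform fun a => g (f a) :=
  (hf.map_comp g).trans hg

theorem prodMap {f : α → β} {g : γ → δ} (hf : PreservesUniform f) (hg : PreservesUniform g) :
    PreservesUniform fun u : α × γ => (f u.1, g u.2) := by
  rw [PreservesUniform, uniform_map_prod]
  calc ((PMF.uniformOfFintype α).bind fun a => (PMF.uniformOfFintype γ).map fun c => (f a, g c))
      = (PMF.uniformOfFintype α).bind fun a => (PMF.uniformOfFintype δ).map (Prod.mk (f a)) :=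
        congrArg _ (funext fun a => hg.map_comp (Prod.mk (f a)))
    _ = (PMF.uniformOfFintype β).bind fun b => (PMF.uniformOfFintype δ).map (Prod.mk b) := by
        rw [← hf, PMF.bind_map]
        rfl
    _ = PMF.uniformOfFintype (β × δ) := (uniform_map_prod id).symm.trans (PMF.map_id _)

end PreservesUniform

theorem preservesUniform_fst : PreservesUniform (Prod.fst : α × β → α) :=
  preservesUniform_snd.comp (preservesUniform_equiv (Equiv.prodComm α β))

theorem uniform_map_prodMk_of_preservesUniform {δ' : Type*} {φ : α → β → γ}
    (hφ : ∀ a, PreservesUniform (φ a)) (f : α → ε) (g : γ → δ') :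
    (PMF.uniformOfFintype (α × β)).map (fun u => (f u.1, g (φ u.1 u.2))) =
      ((PMF.uniformOfFintype α).map f).bind fun d =>
        (PMF.uniformOfFintype γ).map fun c => (d, g c) := by
  rw [uniform_map_prod, PMF.bind_map]
  exact congrArg _ (funext fun a => (hφ a).map_comp fun c => (f a, g c))

theorem preservesUniform_xor {ι κ : Type*} [Fintype ι] [Fintype κ] [DecidableEq ι] [DecidableEq κ]
    (v : ι → κ → Bool) : PreservesUniform fun (b : ι → κ → Bool) i j => xor (v i j) (b i j) :=
  preservesUniform_of_bijective <| Function.Involutive.bijective fun b => by simp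

theorem uniform_map_congr_of_injective {f g : α → ε} {φ : α → α} (hφ : Function.Injective φ)
    (h : ∀ a, f (φ a) = g a) :
    (PMF.uniformOfFintype α).map f = (PMF.uniformOfFintype α).map g := by
  have hb := preservesUniform_of_bijective (Finite.injective_iff_bijective.mp hφ)
  rw [← hb.map_comp f, funext h]

theorem pmf_apply_true (p : PMF Bool) : p true = 1 - p false := by
  refine ENNReal.eq_sub_of_add_eq (p.apply_ne_top _) ?_
  simpa using p.tsum_coe

theorem uniform_map_true_le_of_injective {i : β → α} (hi : Function.Injective i) {f : β → Bool}
    {g : α → Bool} (hg : ∀ a ∉ Set.range i, g a = true) (hfg : ∀ b, f b = true → g (i b) = true) :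
    (PMF.uniformOfFintype β).map f true ≤ (PMF.uniformOfFintype α).map g true := by
  classical
  rw [pmf_apply_true, pmf_apply_true, uniform_map_apply, uniform_map_apply]
  have hsub : (Finset.univ.filter fun a => g a = false) ⊆
      (Finset.univ.filter fun b => f b = false).image i := by
    intro a ha
    simp only [Finset.mem_image, Finset.mem_filter, Finset.mem_univ, true_and] at ha ⊢
    obtain ⟨b, rfl⟩ : a ∈ Set.range i := by_contra fun h => by simp [hg a h] at ha
    exact ⟨b, by_contra fun h => by simp [hfg b (by simpa using h)] at ha, rfl⟩
  have hcard := (Finset.card_le_card hsub).trans Finset.card_image_le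
  have hle := Fintype.card_le_of_injective i hi
  gcongr

end Uniform

/-! ### Binomial noise as a count of uniform bits -/

section Noise

/-- The number of ones of a family of bits, the noise of a prover that has committed to them. -/
def countTrue {ι : Type*} [Fintype ι] (u : ι → Bool) : ℕ :=
  (Finset.univ.filter fun j => u j = true).card

theorem cast_countTrue {q : ℕ} {ι : Type*} [Fintype ι] (u : ι → Bool) :
    (countTrue u : ZMod q) = ∑ j, bitVal (u j) :=
  (Finset.natCast_card_filter _ _).trans rfl

theorem card_filter_countTrue_eq {ι : Type*} [Fintype ι] [DecidableEq ι] (i : ℕ) :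
    (Finset.univ.filter fun u : ι → Bool => countTrue u = i).card = (Fintype.card ι).choose i := by
  rw [← Finset.card_univ, ← Finset.card_powersetCard]
  refine Finset.card_bij' (fun u _ => Finset.univ.filter fun j => u j = true)
    (fun s _ j => decide (j ∈ s)) ?_ ?_ ?_ ?_ <;>
  simp only [Finset.mem_filter_univ, Finset.mem_powersetCard_univ] <;> simp [countTrue]

theorem binomialHalf_map_val (n : ℕ) :
    (binomialHalf n).map Fin.val = (PMF.uniformOfFintype (Fin n → Bool)).map countTrue := by
  ext i
  rw [uniform_map_apply, card_filter_countTrue_eq, PMF.map_apply, tsum_fintype]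
  simp only [eq_comm (a := i), Fintype.card_fin, Fintype.card_pi, Fintype.card_bool,
    Finset.prod_const, Finset.card_univ, Nat.cast_pow, Nat.cast_ofNat]
  by_cases hi : i < n + 1
  · rw [Finset.sum_eq_single_of_mem (⟨i, hi⟩ : Fin (n + 1)) (Finset.mem_univ _)
      fun j _ hj => if_neg fun h => hj (Fin.ext h), if_pos rfl]
    rfl
  · rw [Finset.sum_eq_zero fun j _ => if_neg (by omega), Nat.choose_eq_zero_of_lt (by omega),
      Nat.cast_zero, ENNReal.zero_div]

theorem noise_eq (nb K : ℕ) :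
    noise nb K = (PMF.uniformOfFintype (Fin K → Fin nb → Bool)).map fun u k => countTrue (u k) := by
  induction K with
  | zero =>
    have h : (fun (u : Fin 0 → Fin nb → Bool) k => countTrue (u k)) = Function.const _ Fin.elim0 :=
      funext fun _ => Subsingleton.elim _ _
    rw [noise, h, PMF.map_const]
  | succ K ih =>
    have hcons := preservesUniform_equiv (Fin.consEquiv fun _ : Fin (K + 1) => Fin nb → Bool)
    let p : ℕ → PMF (Fin (K + 1) → ℕ) := fun a =>
      (noise nb K).map fun f => Fin.cons (α := fun _ => ℕ) a f
    calc noise nb (K + 1)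
        = ((binomialHalf nb).map Fin.val).bind p := (PMF.bind_map _ _ p).symm
      _ = (PMF.uniformOfFintype (Fin nb → Bool)).bind fun a => p (countTrue a) := by
          rw [binomialHalf_map_val, PMF.bind_map]
          rfl
      _ = _ := by
          simp only [p, ih, ← hcons.map_comp, uniform_map_prod, PMF.map_comp]
          congr! with a u k
          cases k using Fin.cases <;> simp [Fin.consEquiv]

theorem mBin_eq {q : ℕ} (nb : ℕ) {K : ℕ} (X : Fin K → ZMod q) :
    mBin nb X = (PMF.uniformOfFintype (Fin K → Fin nb → Bool)).map fun u =>
      (∑ k, (X k + ∑ j, bitVal (u k j)), fun k => ∑ j, bitVal (u k j)) := by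
  simp only [mBin, noise_eq, PMF.map_comp, Function.comp_def, cast_countTrue]

end Noise

/-! ### Pedersen commitments -/

section Power

variable {q : ℕ} {M : Type*} [Monoid M]

theorem pow_val_add [NeZero q] {x : M} (hx : x ^ q = 1) (a b : ZMod q) :
    x ^ (a + b).val = x ^ a.val * x ^ b.val := by
  rw [ZMod.val_add, ← pow_add, ← pow_eq_pow_mod _ hx]

theorem pow_val_mul {x : M} (hx : x ^ q = 1) (a b : ZMod q) :
    x ^ (a * b).val = (x ^ a.val) ^ b.val := by
  rw [ZMod.val_mul, ← pow_mul, ← pow_eq_pow_mod _ hx]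

end Power

namespace PrimeGroup

variable {q : ℕ} {P : PrimeGroup q}

theorem pow_order (x : P.carrier) : x ^ q = 1 := by
  simpa only [P.card_eq] using pow_card_eq_one' (x := x)

theorem orderOf_gen (P : PrimeGroup q) : orderOf P.gen = q :=
  (orderOf_eq_card_of_forall_mem_zpowers P.gen_generates).trans P.card_eq

/-- The power of the distinguished generator with exponent in `ℤ_q`; its inverse is the discrete
logarithm. -/
def exp (P : PrimeGroup q) (z : ZMod q) : P.carrier := P.gen ^ z.val

theorem exp_injective [NeZero q] : Function.Injective P.exp := by
  refine fun a b hab => ZMod.val_injective q (pow_injOn_Iio_orderOf ?_ ?_ hab) <;>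
    rw [orderOf_gen, Set.mem_Iio] <;> exact ZMod.val_lt _

end PrimeGroup

theorem GroupGen.h_eq_exp (S : GroupGen) {κ : ℕ} (pp : S.PP κ) :
    S.h pp = (S.gp pp).exp (pp.2 : ZMod (S.q κ)) := rfl

section Commitment

variable {q : ℕ} [NeZero q] {P : PrimeGroup q} {h : P.carrier}

theorem com_add (m m' r r' : ZMod q) :
    com P h (m + m') (r + r') = com P h m r * com P h m' r' := by
  simp only [com, pow_val_add (P.pow_order _), mul_mul_mul_comm]

/-- The homomorphism that sends an opening to its commitment. -/
def comHom (P : PrimeGroup q) (h : P.carrier) : Multiplicative (ZMod q × ZMod q) →* P.carrier where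
  toFun u := com P h u.toAdd.1 u.toAdd.2
  map_one' := by simp [com]
  map_mul' u u' := com_add u.toAdd.1 u'.toAdd.1 u.toAdd.2 u'.toAdd.2

theorem com_neg (m r : ZMod q) : com P h (-m) (-r) = (com P h m r)⁻¹ :=
  map_inv (comHom P h) (.ofAdd (m, r))

theorem com_sum {ι : Type*} (s : Finset ι) (m r : ι → ZMod q) :
    com P h (∑ i ∈ s, m i) (∑ i ∈ s, r i) = ∏ i ∈ s, com P h (m i) (r i) := by
  simpa only [← ofAdd_sum, comHom, MonoidHom.coe_mk, OneHom.coe_mk, toAdd_ofAdd, Prod.fst_sum,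
    Prod.snd_sum] using map_prod (comHom P h) (fun i => .ofAdd (m i, r i)) s

theorem com_exp (a m r : ZMod q) : com P (P.exp a) m r = P.exp (m + a * r) := by
  simp only [com, PrimeGroup.exp, pow_val_add (P.pow_order _), pow_val_mul (P.pow_order _)]

theorem com_exp_inj {a m r m' r' : ZMod q} :
    com P (P.exp a) m r = com P (P.exp a) m' r' ↔ m + a * r = m' + a * r' := by
  rw [com_exp, com_exp, PrimeGroup.exp_injective.eq_iff]

omit [NeZero q] in
theorem orOracle_eq_true {c : P.carrier} {v s : ZMod q} :
    orOracle P h c v s = true ↔ (v = 0 ∨ v = 1) ∧ c = com P h v s :=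
  @decide_eq_true_iff _ (_)

theorem valid_eq_true {n K : ℕ} {x : Fin n → ZMod q} {sh : Fin K → Fin n → ZMod q}
    (hsh : ∀ i, ∑ k, sh k i = x i) (r : Fin K → Fin n → ZMod q) (i : Fin n) :
    valid P h x sh r i = true ↔ x i = 0 ∨ x i = 1 := by
  simp only [valid, clientCom, ← com_sum, hsh, orOracle_eq_true, and_true]

theorem filter_valid_eq_legal {n K : ℕ} {x : Fin n → ZMod q} {sh : Fin K → Fin n → ZMod q}
    (hsh : ∀ i, ∑ k, sh k i = x i) (r : Fin K → Fin n → ZMod q) :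
    (Finset.univ.filter fun i => valid P h x sh r i = true) = legal x :=
  Finset.filter_congr fun i _ => valid_eq_true hsh r i

end Commitment

section Trapdoor

variable {q : ℕ} [Fact q.Prime] {P : PrimeGroup q}

theorem com_equivocate {a : ZMod q} (ha : a ≠ 0) (m r d : ZMod q) :
    com P (P.exp a) (m + d) (r - a⁻¹ * d) = com P (P.exp a) m r := by
  rw [com_exp_inj]
  field_simp
  ring

/-- The logarithm of `h` that two openings `u` and `u'` of one commitment reveal, if their first
components differ. -/
def openingsLog (u u' : ZMod q × ZMod q) : ZMod q := (u'.1 - u.1) * (u.2 - u'.2)⁻¹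

theorem openingsLog_eq {a : ZMod q} {u u' : ZMod q × ZMod q}
    (hcom : com P (P.exp a) u.1 u.2 = com P (P.exp a) u'.1 u'.2) (hne : u'.1 ≠ u.1) :
    openingsLog u u' = a := by
  have hlin : a * (u.2 - u'.2) = u'.1 - u.1 := by linear_combination com_exp_inj.mp hcom
  have hne' : u.2 - u'.2 ≠ 0 := fun h0 => hne (sub_eq_zero.mp (by rw [← hlin, h0, mul_zero]))
  rw [openingsLog, ← hlin, mul_inv_cancel_right₀ hne']

end Trapdoor

/-! ### Flipping committed bits by public coins -/

section Flip

variable {q : ℕ}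

/-- The bit `v̂` of the protocol: the committed bit `v`, flipped if the public coin is one. -/
def flipBit (b : Bool) (v : ZMod q) : ZMod q := if b then 1 - v else v

/-- The commitment randomness `ŝ` of the bit `v̂`. -/
def flipRand (b : Bool) (s : ZMod q) : ZMod q := if b then -s else s

/-- The commitment `ĉ'` to the bit `v̂`. -/
def flipCom (P : PrimeGroup q) (h : P.carrier) (b : Bool) (c : P.carrier) : P.carrier :=
  if b then com P h 1 0 * c⁻¹ else c

theorem flipCom_com [NeZero q] {P : PrimeGroup q} {h : P.carrier} (b : Bool) (v s : ZMod q) :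
    flipCom P h b (com P h v s) = com P h (flipBit b v) (flipRand b s) := by
  cases b
  · rfl
  · simp only [flipCom, flipBit, flipRand, if_true, ← com_neg, ← com_add, zero_add, sub_eq_add_neg]

theorem bitVal_eq_zero_or_one (v : Bool) : (bitVal v : ZMod q) = 0 ∨ (bitVal v : ZMod q) = 1 := by
  cases v <;> simp [bitVal]

theorem bitVal_xor (v b : Bool) : (bitVal (xor v b) : ZMod q) = flipBit b (bitVal v) := by
  cases v <;> cases b <;> simp [bitVal, flipBit]

/-- The opening of the product of the commitments with openings `(sh i, r i)`, for `i ∈ L`, and of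
the flipped commitments with openings `(v j, s j)`: the message `(y_k, z_k)` that the verifier
expects from prover `k`. -/
def aggregate {ι ι' : Type*} [Fintype ι'] (L : Finset ι) (sh r : ι → ZMod q) (v s : ι' → ZMod q)
    (b : ι' → Bool) : ZMod q × ZMod q :=
  (∑ i ∈ L, sh i + ∑ j, flipBit (b j) (v j), ∑ i ∈ L, r i + ∑ j, flipRand (b j) (s j))

theorem check_com_eq_true [NeZero q] {P : PrimeGroup q} {h : P.carrier} {n nb : ℕ}
    (va : Fin n → Bool) (sh r : Fin n → ZMod q) (v s : Fin nb → ZMod q) (b : Fin nb → Bool)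
    (yz : ZMod q × ZMod q) :
    check P h va (fun i => com P h (sh i) (r i)) (fun j => com P h (v j) (s j)) b yz = true ↔
      com P h (aggregate (Finset.univ.filter fun i => va i = true) sh r v s b).1
        (aggregate (Finset.univ.filter fun i => va i = true) sh r v s b).2 =
          com P h yz.1 yz.2 := by
  simp only [aggregate, com_add, com_sum, ← flipCom_com]
  exact @decide_eq_true_iff _ (_)

theorem sum_sum_shares {ι κ : Type*} [Fintype κ] {x : ι → ZMod q} {sh : κ → ι → ZMod q}
    (hsh : ∀ i, ∑ k, sh k i = x i) (L : Finset ι) : ∑ k, ∑ i ∈ L, sh k i = ∑ i ∈ L, x i := by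
  rw [Finset.sum_comm]
  exact Finset.sum_congr rfl fun i _ => hsh i

end Flip

/-! ### Completeness -/

section Honest

variable {q : ℕ} {n nb K : ℕ}

namespace PartyRand

/-- The commitment randomness of the clients. -/
abbrev r (w : PartyRand q n nb K) : Fin K → Fin n → ZMod q := w.1

/-- The private bits of the provers. -/
abbrev v (w : PartyRand q n nb K) : Fin K → Fin nb → Bool := w.2.1

/-- The commitment randomness of the provers. -/
abbrev s (w : PartyRand q n nb K) : Fin K → Fin nb → ZMod q := w.2.2.1

/-- The public coins. -/
abbrev b (w : PartyRand q n nb K) : Fin K → Fin nb → Bool := w.2.2.2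

end PartyRand

theorem preservesUniform_xor_coins [NeZero q] :
    PreservesUniform fun (w : PartyRand q n nb K) k j => xor (w.v k j) (w.b k j) :=
  preservesUniform_uncurry fun _ => preservesUniform_uncurry fun v =>
    preservesUniform_uncurry fun _ => preservesUniform_xor v

/-- The final messages of honest provers. -/
noncomputable def honestResponse (P : PrimeGroup q) (h : P.carrier) (x : Fin n → ZMod q)
    (sh : Fin K → Fin n → ZMod q) (w : PartyRand q n nb K) (k : Fin K) : ZMod q × ZMod q :=
  response (valid P h x sh w.r) (sh k) (w.r k) (w.v k) (w.s k) (w.b k)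

variable [NeZero q] {P : PrimeGroup q} {h : P.carrier} {x : Fin n → ZMod q}
  {sh : Fin K → Fin n → ZMod q}

theorem honestResponse_eq_aggregate (hsh : ∀ i, ∑ k, sh k i = x i) (w : PartyRand q n nb K)
    (k : Fin K) :
    honestResponse P h x sh w k =
      aggregate (legal x) (sh k) (w.r k) (fun j => bitVal (w.v k j)) (w.s k) (w.b k) := by
  rw [← filter_valid_eq_legal hsh w.r]
  rfl

theorem honestOutcome_accept (w : PartyRand q n nb K) :
    (honestOutcome P h x sh w).accept = true := by
  simp only [honestOutcome, Bool.and_eq_true, decide_eq_true_eq, orOracle_eq_true, and_true]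
  exact ⟨fun k j => bitVal_eq_zero_or_one _, fun k => (check_com_eq_true ..).mpr rfl⟩

theorem honestOutcome_y (hsh : ∀ i, ∑ k, sh k i = x i) (w : PartyRand q n nb K) :
    (honestOutcome P h x sh w).y =
      ∑ k, (∑ i ∈ legal x, sh k i + ∑ j, bitVal (xor (w.v k j) (w.b k j))) := by
  have hy : (honestOutcome P h x sh w).y = ∑ k, (honestResponse P h x sh w k).1 := rfl
  simp only [hy, honestResponse_eq_aggregate hsh, aggregate, bitVal_xor]

end Honest

theorem honestExp_accept_false (S : GroupGen) (N : Sizes) (κ : ℕ) (x : Fin (N.n κ) → ZMod (S.q κ))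
    (sh : Fin (N.K κ) → Fin (N.n κ) → ZMod (S.q κ)) :
    (honestExp S N κ x sh).map (fun o => o.accept) false = 0 := by
  have haccept : (honestExp S N κ x sh).map (fun o => o.accept) = PMF.pure true := by
    simp only [honestExp, PMF.map_bind, PMF.map_comp, Function.comp_def, honestOutcome_accept]
    exact (congrArg _ (funext fun _ => PMF.map_const _ _)).trans (PMF.bind_const _ _)
  simp [haccept]

theorem honestExp_output (S : GroupGen) (N : Sizes) {κ : ℕ} {x : Fin (N.n κ) → ZMod (S.q κ)}
    {sh : Fin (N.K κ) → Fin (N.n κ) → ZMod (S.q κ)} (hsh : ∀ i, ∑ k, sh k i = x i) :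
    (honestExp S N κ x sh).map (fun o => o.y) =
      (mBin (N.nb κ) fun k => ∑ i ∈ legal x, sh k i).map Prod.fst := by
  simp only [honestExp, PMF.map_bind, PMF.map_comp, Function.comp_def, honestOutcome_y hsh, mBin_eq]
  rw [PMF.bind_const, ← (preservesUniform_xor_coins (q := S.q κ) (n := N.n κ)).map_comp]

/-! ### Executions with corrupted provers -/

section Attack

/-- The values of a random tape of length `m`. -/
abbrev Tape (q m : ℕ) : Type := (Fin m → Bool) × (Fin m → ZMod q)

/-- The randomness of an execution with an adversary that tosses `m` coins. -/
abbrev ExecRand (q n nb K m : ℕ) : Type := Tape q m × PartyRand q n nb K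

/-- Separates the public coins from the randomness that is used before they are tossed. -/
def execRandEquiv (q n nb K m : ℕ) :
    (Tape q m × (Fin K → Fin n → ZMod q) × (Fin K → Fin nb → Bool) × (Fin K → Fin nb → ZMod q)) ×
      (Fin K → Fin nb → Bool) ≃ ExecRand q n nb K m where
  toFun u := (u.1.1, u.1.2.1, u.1.2.2.1, u.1.2.2.2, u.2)
  invFun w := ((w.1, w.2.r, w.2.v, w.2.s), w.2.b)

variable {q : ℕ} (P : PrimeGroup q) (h : P.carrier) {n nb K m l : ℕ}
  (A : ProverAttack n nb K m l) (I : Finset (Fin K)) (aux : Fin l → Bool)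
  (x : Fin n → ZMod q) (sh : Fin K → Fin n → ZMod q)

/-- The view of corrupted provers before they commit to their private bits. -/
noncomputable def commitView (w : ExecRand q n nb K m) :
    (Ty.prod (.start n K m l) (.pow (.pow .grp nb) K)).El P :=
  (startView P h I aux x sh w.2.r w.1, honestComs P h I w.2.v w.2.s)

/-- The openings that the bit proof oracle is given, of the commitments of all provers. -/
noncomputable def proverOpening (w : ExecRand q n nb K m) (k : Fin K) (j : Fin nb) :
    ZMod q × ZMod q :=
  if k ∈ I then (A.commit.eval P (commitView P h I aux x sh w) k j).2
  else (bitVal (w.2.v k j), w.2.s k j)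

/-- The final messages of all provers. -/
noncomputable def proverResponse (w : ExecRand q n nb K m) (k : Fin K) : ZMod q × ZMod q :=
  if k ∈ I then A.respond.eval P (commitView P h I aux x sh w, w.2.b,
    fun k => if k ∈ I then (0, 0) else honestResponse P h x sh w.2 k) k
  else honestResponse P h x sh w.2 k

/-- The final message of prover `k` that the openings of the individual commitments determine. -/
noncomputable def expectedResponse (w : ExecRand q n nb K m) (k : Fin K) : ZMod q × ZMod q :=
  aggregate (legal x) (sh k) (w.2.r k) (fun j => (proverOpening P h A I aux x sh w k j).1)
    (fun j => (proverOpening P h A I aux x sh w k j).2) (w.2.b k)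

theorem attackOutcome_y (w : ExecRand q n nb K m) :
    (attackOutcome P h A I aux x sh w).y = ∑ k, (proverResponse P h A I aux x sh w k).1 :=
  rfl

theorem attackOutcome_ideal (w : ExecRand q n nb K m) :
    (attackOutcome P h A I aux x sh w).ideal = ∑ i ∈ legal x, x i +
      ∑ k, ∑ j, bitVal (xor (decide ((proverOpening P h A I aux x sh w k j).1 = 1)) (w.2.b k j)) :=
  rfl

theorem attackOutcome_accept {w : ExecRand q n nb K m}
    (hacc : (attackOutcome P h A I aux x sh w).accept = true) :
    ∃ c : Fin K → Fin nb → P.carrier,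
      (∀ k j, orOracle P h (c k j) (proverOpening P h A I aux x sh w k j).1
        (proverOpening P h A I aux x sh w k j).2 = true) ∧
      ∀ k, check P h (valid P h x sh w.2.r) (clientCom P h sh w.2.r k) (c k) (w.2.b k)
        (proverResponse P h A I aux x sh w k) = true :=
  have hand := (Bool.and_eq_true _ _).mp hacc
  ⟨_, of_decide_eq_true hand.1, of_decide_eq_true hand.2⟩

variable {P h A I aux x sh}

theorem proverResponse_eq_expectedResponse [NeZero q] (hsh : ∀ i, ∑ k, sh k i = x i)
    (w : ExecRand q n nb K m) {k : Fin K} (hk : k ∉ I) :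
    proverResponse P h A I aux x sh w k = expectedResponse P h A I aux x sh w k := by
  simp only [proverResponse, expectedResponse, proverOpening, if_neg hk,
    honestResponse_eq_aggregate hsh]

theorem proverOpening_of_accept {w : ExecRand q n nb K m}
    (hacc : (attackOutcome P h A I aux x sh w).accept = true) (k : Fin K) (j : Fin nb) :
    (proverOpening P h A I aux x sh w k j).1 = 0 ∨
      (proverOpening P h A I aux x sh w k j).1 = 1 := by
  obtain ⟨c, hor, -⟩ := attackOutcome_accept P h A I aux x sh hacc
  exact (orOracle_eq_true.mp (hor k j)).1

theorem com_expectedResponse_of_accept [NeZero q] (hsh : ∀ i, ∑ k, sh k i = x i)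
    {w : ExecRand q n nb K m} (hacc : (attackOutcome P h A I aux x sh w).accept = true)
    (k : Fin K) :
    com P h (expectedResponse P h A I aux x sh w k).1 (expectedResponse P h A I aux x sh w k).2 =
      com P h (proverResponse P h A I aux x sh w k).1 (proverResponse P h A I aux x sh w k).2 := by
  obtain ⟨c, hor, hcheck⟩ := attackOutcome_accept P h A I aux x sh hacc
  have hc : c k = fun j => com P h (proverOpening P h A I aux x sh w k j).1
      (proverOpening P h A I aux x sh w k j).2 :=
    funext fun j => (orOracle_eq_true.mp (hor k j)).2
  have hk := hcheck k
  rw [hc] at hk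
  simpa only [expectedResponse, filter_valid_eq_legal hsh] using (check_com_eq_true ..).mp hk

theorem attackOutcome_ideal_of_accept (hsh : ∀ i, ∑ k, sh k i = x i) {w : ExecRand q n nb K m}
    (hacc : (attackOutcome P h A I aux x sh w).accept = true) :
    (attackOutcome P h A I aux x sh w).ideal =
      ∑ k, (expectedResponse P h A I aux x sh w k).1 := by
  have hbit (k j) : bitVal (decide ((proverOpening P h A I aux x sh w k j).1 = 1)) =
      (proverOpening P h A I aux x sh w k j).1 := by
    rcases proverOpening_of_accept hacc k j with h0 | h1
    · by_cases h01 : (0 : ZMod q) = 1 <;> simp [h0, h01, bitVal]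
    · simp [h1, bitVal]
  simp only [attackOutcome_ideal, expectedResponse, aggregate, Finset.sum_add_distrib,
    sum_sum_shares hsh, bitVal_xor, hbit]

theorem exists_openingsLog_eq_of_cheat [Fact q.Prime] {a : ZMod q}
    (hsh : ∀ i, ∑ k, sh k i = x i) {w : ExecRand q n nb K m}
    (hacc : (attackOutcome P (P.exp a) A I aux x sh w).accept = true)
    (hne : (attackOutcome P (P.exp a) A I aux x sh w).y ≠
      (attackOutcome P (P.exp a) A I aux x sh w).ideal) :
    ∃ k ∈ I, openingsLog (expectedResponse P (P.exp a) A I aux x sh w k)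
      (proverResponse P (P.exp a) A I aux x sh w k) = a := by
  rw [attackOutcome_y, attackOutcome_ideal_of_accept hsh hacc] at hne
  obtain ⟨k, hk⟩ : ∃ k, (proverResponse P (P.exp a) A I aux x sh w k).1 ≠
      (expectedResponse P (P.exp a) A I aux x sh w k).1 := by
    by_contra! hall
    exact hne (Finset.sum_congr rfl fun k _ => hall k)
  have hkI : k ∈ I := by_contra fun hkI => hk (by rw [proverResponse_eq_expectedResponse hsh w hkI])
  exact ⟨k, hkI, openingsLog_eq (com_expectedResponse_of_accept hsh hacc k) hk⟩

theorem uniform_map_started_ideal [NeZero q] (hsh : ∀ i, ∑ k, sh k i = x i) :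
    (PMF.uniformOfFintype (ExecRand q n nb K m)).map
        (fun w => ((attackOutcome P h A I aux x sh w).started,
          (attackOutcome P h A I aux x sh w).ideal)) =
      ((PMF.uniformOfFintype (ExecRand q n nb K m)).map
        fun w => (attackOutcome P h A I aux x sh w).started).bind fun st =>
          (mBin nb fun k => ∑ i ∈ legal x, sh k i).map fun out => (st, out.1) := by
  let e := execRandEquiv q n nb K m
  have he : PreservesUniform e := preservesUniform_equiv e
  let started c := (attackOutcome P h A I aux x sh (e (c, fun _ _ => false))).started
  let bits c k j := decide ((proverOpening P h A I aux x sh (e (c, fun _ _ => false)) k j).1 = 1)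
  have hideal (u) : (attackOutcome P h A I aux x sh (e u)).ideal =
      ∑ k, (∑ i ∈ legal x, sh k i + ∑ j, bitVal (xor (bits u.1 k j) (u.2 k j))) := by
    rw [attackOutcome_ideal, Finset.sum_add_distrib, sum_sum_shares hsh]
    rfl
  have hstarted (u) : (attackOutcome P h A I aux x sh (e u)).started = started u.1 := rfl
  simp only [mBin_eq, PMF.map_comp, Function.comp_def, ← he.map_comp, hideal, hstarted,
    preservesUniform_fst.map_comp started]
  exact uniform_map_prodMk_of_preservesUniform (fun c => preservesUniform_xor (bits c)) started
    fun b : Fin K → Fin nb → Bool => ∑ k, (∑ i ∈ legal x, sh k i + ∑ j, bitVal (b k j))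

end Attack

theorem attackExp_started_ideal (S : GroupGen) {N : Sizes} (A : ProverAdversary N) {κ : ℕ}
    (I : Finset (Fin (N.K κ))) (aux : Fin (A.auxLen κ) → Bool) {x : Fin (N.n κ) → ZMod (S.q κ)}
    {sh : Fin (N.K κ) → Fin (N.n κ) → ZMod (S.q κ)} (hsh : ∀ i, ∑ k, sh k i = x i) :
    (attackExp S A κ I aux x sh).map (fun o => (o.started, o.ideal)) =
      ((attackExp S A κ I aux x sh).map fun o => o.started).bind fun st =>
        (mBin (N.nb κ) fun k => ∑ i ∈ legal x, sh k i).map fun out => (st, out.1) := by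
  simp only [attackExp, PMF.map_bind, PMF.bind_bind, PMF.map_comp, Function.comp_def]
  exact congrArg _ (funext fun pp => uniform_map_started_ideal hsh)

/-! ### Polynomial bounds -/

namespace PolyBounded

variable {f g : ℕ → ℕ}

theorem const (c : ℕ) : PolyBounded fun _ => c :=
  ⟨.C c, fun κ => by simp⟩

theorem add (hf : PolyBounded f) (hg : PolyBounded g) : PolyBounded fun κ => f κ + g κ := by
  obtain ⟨p, hp⟩ := hf
  obtain ⟨p', hp'⟩ := hg
  exact ⟨p + p', fun κ => by simpa using add_le_add (hp κ) (hp' κ)⟩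

theorem mul (hf : PolyBounded f) (hg : PolyBounded g) : PolyBounded fun κ => f κ * g κ := by
  obtain ⟨p, hp⟩ := hf
  obtain ⟨p', hp'⟩ := hg
  exact ⟨p * p', fun κ => by simpa using Nat.mul_le_mul (hp κ) (hp' κ)⟩

end PolyBounded

/-! ### Circuit combinators -/

namespace Circ

section Combinators

variable {a b c : Ty} {n : ℕ}

/-- An entry of a tuple. -/
def entry (f : Circ a (.pow b n)) (i : Fin n) : Circ a b := .comp f (.proj b i)

/-- An entry of a matrix. -/
def entry₂ {m : ℕ} (f : Circ a (.pow (.pow b n) m)) (i : Fin m) (j : Fin n) : Circ a b :=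
  (f.entry i).entry j

/-- The first component of a pair. -/
def left (f : Circ a (.prod b c)) : Circ a b := .comp f (.fst b c)

/-- The second component of a pair. -/
def right (f : Circ a (.prod b c)) : Circ a c := .comp f (.snd b c)

/-- A constant of `ℤ_q`. -/
def const {q : ℕ} (a : Ty) (z : ZMod q) : Circ a .fld := .fconst a z.val

/-- Addition in `ℤ_q`. -/
def add (f g : Circ a .fld) : Circ a .fld := .comp (.pair f g) .fadd

/-- Multiplication in `ℤ_q`. -/
def mul (f g : Circ a .fld) : Circ a .fld := .comp (.pair f g) .fmul

/-- Subtraction in `ℤ_q`. -/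
def sub (f g : Circ a .fld) : Circ a .fld := f.add ((fconst a (-1)).mul g)

/-- Inversion in `ℤ_q`. -/
def inv (f : Circ a .fld) : Circ a .fld := .comp f .finv

/-- Conversion of a bit to an element of `ℤ_q`. -/
def ofBit (f : Circ a .bit) : Circ a .fld := .comp f .fofbit

/-- Negation of a bit. -/
def not (f : Circ a .bit) : Circ a .bit := .comp f .bnot

/-- Conjunction of bits. -/
def and (f g : Circ a .bit) : Circ a .bit := .comp (.pair f g) .band

/-- A choice between two elements of `ℤ_q`. -/
def mux (c : Circ a .bit) (f g : Circ a .fld) : Circ a .fld :=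
  (c.ofBit.mul f).add (c.not.ofBit.mul g)

/-- The sum of a family. -/
def sum : {n : ℕ} → (Fin n → Circ a .fld) → Circ a .fld
  | 0, _ => .fconst a 0
  | _ + 1, f => (f 0).add (sum fun i => f i.succ)

/-- The sum of the entries of a family that are selected by bits. -/
def sumWhere (c : Fin n → Circ a .bit) (f : Fin n → Circ a .fld) : Circ a .fld :=
  sum fun i => (c i).mux (f i) (.fconst a 0)

/-- The group operation. -/
def times (f g : Circ a .grp) : Circ a .grp := .comp (.pair f g) .gmul

/-- Powers of group elements. -/
def power (f : Circ a .grp) (g : Circ a .fld) : Circ a .grp := .comp (.pair f g) .gpow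

/-- The neutral element of the group. -/
def one (a : Ty) : Circ a .grp := (ggen a).power (.fconst a 0)

/-- Inversion in the group. -/
def ginv (f : Circ a .grp) : Circ a .grp := f.power (.fconst a (-1))

/-- Equality of group elements. -/
def eqG (f g : Circ a .grp) : Circ a .bit := .comp (.pair f g) .geq

/-- A choice between two group elements. -/
def gmux (c : Circ a .bit) (f g : Circ a .grp) : Circ a .grp :=
  (f.power c.ofBit).times (g.power c.not.ofBit)

/-- The product of a family. -/
def product : {n : ℕ} → (Fin n → Circ a .grp) → Circ a .grp
  | 0, _ => .one a
  | _ + 1, f => (f 0).times (product fun i => f i.succ)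

/-- The product of the entries of a family that are selected by bits. -/
def productWhere (c : Fin n → Circ a .bit) (f : Fin n → Circ a .grp) : Circ a .grp :=
  product fun i => (c i).gmux (f i) (.one a)

/-- The Pedersen commitment to `m` with randomness `r`. -/
def commit (h : Circ a .grp) (m r : Circ a .fld) : Circ a .grp :=
  ((ggen a).power m).times (h.power r)

/-- A circuit for `flipBit`. -/
def flipBit (b : Circ a .bit) (v : Circ a .fld) : Circ a .fld := b.mux ((fconst a 1).sub v) v

/-- A circuit for `flipRand`. -/
def flipRand (b : Circ a .bit) (s : Circ a .fld) : Circ a .fld := b.mux ((fconst a 0).sub s) s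

/-- A circuit for `flipCom`. -/
def flipCom (h : Circ a .grp) (b : Circ a .bit) (c : Circ a .grp) : Circ a .grp :=
  b.gmux ((commit h (.fconst a 1) (.fconst a 0)).times c.ginv) c

/-- A circuit for `aggregate`, for the clients that are selected by the bits `va`. -/
def aggregate {nb : ℕ} (va : Fin n → Circ a .bit) (sh r : Fin n → Circ a .fld)
    (v s : Fin nb → Circ a .fld) (b : Fin nb → Circ a .bit) : Circ a (.prod .fld .fld) :=
  .pair ((sumWhere va sh).add (sum fun j => (b j).flipBit (v j)))
    ((sumWhere va r).add (sum fun j => (b j).flipRand (s j)))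

/-- A circuit for `openingsLog`. -/
def openingsLog (u u' : Circ a (.prod .fld .fld)) : Circ a .fld :=
  (u'.left.sub u.left).mul (u.right.sub u'.right).inv

/-- The first entry of a tuple that is a discrete logarithm of `h`, and `0` if there is none. -/
def firstLog (h : Circ a .grp) : {n : ℕ} → (Fin n → Circ a .fld) → Circ a .fld
  | 0, _ => .fconst a 0
  | _ + 1, f => (eqG ((ggen a).power (f 0)) h).mux (f 0) (firstLog h fun i => f i.succ)

end Combinators

section Eval

variable {a b c : Ty} {n : ℕ} {q : ℕ} (P : PrimeGroup q) (u : a.El P)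

@[simp] theorem eval_comp (f : Circ a b) (g : Circ b c) :
    (comp f g).eval P u = g.eval P (f.eval P u) := rfl

@[simp] theorem eval_pair (f : Circ a b) (g : Circ a c) :
    (pair f g).eval P u = (f.eval P u, g.eval P u) := rfl

@[simp] theorem eval_tup (f : Fin n → Circ a b) :
    (tup f).eval P u = fun i => (f i).eval P u := rfl

@[simp] theorem eval_entry (f : Circ a (.pow b n)) (i : Fin n) :
    (f.entry i).eval P u = f.eval P u i := rfl

@[simp] theorem eval_entry₂ {m : ℕ} (f : Circ a (.pow (.pow b n) m)) (i : Fin m) (j : Fin n) :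
    (f.entry₂ i j).eval P u = f.eval P u i j := rfl

@[simp] theorem eval_left (f : Circ a (.prod b c)) : f.left.eval P u = (f.eval P u).1 := rfl

@[simp] theorem eval_right (f : Circ a (.prod b c)) : f.right.eval P u = (f.eval P u).2 := rfl

@[simp] theorem eval_bconst (t : Bool) : (bconst a t).eval P u = t := rfl

@[simp] theorem eval_fconst (t : ℤ) : (fconst a t).eval P u = (t : ZMod q) := rfl

@[simp] theorem eval_const [NeZero q] (z : ZMod q) : (const a z).eval P u = z := by
  rw [const, eval_fconst, Int.cast_natCast, ZMod.natCast_zmod_val]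

@[simp] theorem eval_add (f g : Circ a .fld) :
    (f.add g).eval P u = f.eval P u + g.eval P u := rfl

@[simp] theorem eval_mul (f g : Circ a .fld) :
    (f.mul g).eval P u = f.eval P u * g.eval P u := rfl

@[simp] theorem eval_sub (f g : Circ a .fld) :
    (f.sub g).eval P u = f.eval P u - g.eval P u := by
  rw [sub, eval_add, eval_mul, eval_fconst, Int.cast_neg, Int.cast_one, neg_one_mul, sub_eq_add_neg]

@[simp] theorem eval_inv (f : Circ a .fld) :
    f.inv.eval P u = Inv.inv (α := ZMod q) (f.eval P u) := rfl

@[simp] theorem eval_ofBit (f : Circ a .bit) : f.ofBit.eval P u = (bitVal (f.eval P u) : ZMod q) :=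
  rfl

@[simp] theorem eval_not (f : Circ a .bit) : f.not.eval P u = !f.eval P u := rfl

@[simp] theorem eval_and (f g : Circ a .bit) :
    (f.and g).eval P u = (f.eval P u && g.eval P u) := rfl

@[simp] theorem eval_mux (c : Circ a .bit) (f g : Circ a .fld) :
    (c.mux f g).eval P u = if c.eval P u = true then f.eval P u else g.eval P u := by
  rw [mux, eval_add, eval_mul, eval_mul, eval_ofBit, eval_ofBit, eval_not]
  cases c.eval P u <;> simp [bitVal]

@[simp] theorem eval_sum (f : Fin n → Circ a .fld) :
    (sum f).eval P u = ∑ i, ((f i).eval P u : ZMod q) := by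
  induction n with
  | zero => exact Int.cast_zero
  | succ n ih => rw [sum, eval_add, ih, Fin.sum_univ_succ]

@[simp] theorem eval_sumWhere (c : Fin n → Circ a .bit) (f : Fin n → Circ a .fld) :
    (sumWhere c f).eval P u = ∑ i with (c i).eval P u = true, ((f i).eval P u : ZMod q) := by
  simp [sumWhere, Finset.sum_filter]

@[simp] theorem eval_times (f g : Circ a .grp) :
    (f.times g).eval P u = f.eval P u * g.eval P u := rfl

@[simp] theorem eval_power (f : Circ a .grp) (g : Circ a .fld) :
    (f.power g).eval P u = f.eval P u ^ ZMod.val (n := q) (g.eval P u) := rfl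

@[simp] theorem eval_one : (one a).eval P u = 1 := by
  simp [one]

@[simp] theorem eval_eqG (f g : Circ a .grp) :
    (f.eqG g).eval P u = true ↔ f.eval P u = g.eval P u :=
  @decide_eq_true_iff _ (_)

@[simp] theorem eval_product (f : Fin n → Circ a .grp) :
    (product f).eval P u = ∏ i, ((f i).eval P u : P.carrier) := by
  induction n with
  | zero => exact eval_one P u
  | succ n ih => rw [product, eval_times, ih, Fin.prod_univ_succ]

@[simp] theorem eval_commit (h : Circ a .grp) (m r : Circ a .fld) :
    (commit h m r).eval P u = com P (h.eval P u) (m.eval P u) (r.eval P u) := rfl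

@[simp] theorem eval_flipBit (b : Circ a .bit) (v : Circ a .fld) :
    (b.flipBit v).eval P u = _root_.flipBit (q := q) (b.eval P u) (v.eval P u) := by
  simp [flipBit, _root_.flipBit]

@[simp] theorem eval_flipRand (b : Circ a .bit) (s : Circ a .fld) :
    (b.flipRand s).eval P u = _root_.flipRand (q := q) (b.eval P u) (s.eval P u) := by
  simp [flipRand, _root_.flipRand]

@[simp] theorem eval_aggregate {nb : ℕ} (va : Fin n → Circ a .bit) (sh r : Fin n → Circ a .fld)
    (v s : Fin nb → Circ a .fld) (b : Fin nb → Circ a .bit) :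
    (aggregate va sh r v s b).eval P u =
      _root_.aggregate (q := q) (Finset.univ.filter fun i => (va i).eval P u = true)
        (fun i => (sh i).eval P u) (fun i => (r i).eval P u) (fun j => (v j).eval P u)
        (fun j => (s j).eval P u) (fun j => (b j).eval P u) := by
  simp [aggregate, _root_.aggregate]

@[simp] theorem eval_openingsLog [Fact q.Prime] (w w' : Circ a (.prod .fld .fld)) :
    (openingsLog w w').eval P u = _root_.openingsLog (q := q) (w.eval P u) (w'.eval P u) := by
  simp [openingsLog, _root_.openingsLog]

theorem eval_firstLog_eq [NeZero q] {z : ZMod q} {h : Circ a .grp} (hz : h.eval P u = P.exp z)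
    {f : Fin n → Circ a .fld} (hf : z = 0 ∨ ∃ i, (f i).eval P u = z) :
    (firstLog h f).eval P u = z := by
  induction n with
  | zero =>
    obtain rfl | ⟨i, -⟩ := hf
    · exact Int.cast_zero
    · exact i.elim0
  | succ n ih =>
    have hlog : (eqG ((ggen a).power (f 0)) h).eval P u = true ↔ (f 0).eval P u = z := by
      rw [eval_eqG, hz]
      exact P.exp_injective.eq_iff
    rw [firstLog, eval_mux]
    split_ifs with h0
    · exact hlog.mp h0
    · refine ih (hf.imp_right ?_)
      rw [Fin.exists_fin_succ]
      exact fun hi => hi.resolve_left fun hi => h0 (hlog.mpr hi)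

variable [Fact q.Prime]

@[simp] theorem eval_ginv (f : Circ a .grp) : f.ginv.eval P u = (f.eval P u : P.carrier)⁻¹ := by
  have hmul := pow_val_add (P.pow_order (f.eval P u)) (-1) 1
  rw [neg_add_cancel, ZMod.val_zero, pow_zero, ZMod.val_one, pow_one] at hmul
  simpa [ginv] using eq_inv_of_mul_eq_one_left hmul.symm

@[simp] theorem eval_gmux (c : Circ a .bit) (f g : Circ a .grp) :
    (c.gmux f g).eval P u = if c.eval P u = true then f.eval P u else g.eval P u := by
  rw [gmux, eval_times, eval_power, eval_power, eval_ofBit, eval_ofBit, eval_not]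
  cases c.eval P u <;> simp [bitVal, ZMod.val_one]

@[simp] theorem eval_productWhere (c : Fin n → Circ a .bit) (f : Fin n → Circ a .grp) :
    (productWhere c f).eval P u =
      ∏ i with (c i).eval P u = true, ((f i).eval P u : P.carrier) := by
  simp [productWhere, Finset.prod_filter]

@[simp] theorem eval_flipCom (h : Circ a .grp) (b : Circ a .bit) (c : Circ a .grp) :
    (flipCom h b c).eval P u =
      _root_.flipCom P (h.eval P u) (b.eval P u) (c.eval P u) := by
  simp [flipCom, _root_.flipCom]

end Eval

section Size

variable {a : Ty} {n : ℕ}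

theorem size_sum (f : Fin n → Circ a .fld) : (sum f).size = ∑ i, ((f i).size + 2) + 1 := by
  induction n with
  | zero => rfl
  | succ n ih =>
    have hadd : (sum f).size = (f 0).size + (sum fun i => f i.succ).size + 2 := rfl
    rw [hadd, ih, Fin.sum_univ_succ]
    ring

theorem size_product (f : Fin n → Circ a .grp) :
    (product f).size = ∑ i, ((f i).size + 2) + (one a).size := by
  induction n with
  | zero => rw [Finset.univ_eq_empty, Finset.sum_empty, zero_add, product]
  | succ n ih =>
    have htimes : (product f).size = (f 0).size + (product fun i => f i.succ).size + 2 := rfl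
    rw [htimes, ih, Fin.sum_univ_succ]
    ring

theorem size_firstLog_le (h : Circ a .grp) (f : Fin n → Circ a .fld) :
    (firstLog h f).size ≤
      ∑ i, ((eqG ((ggen a).power (f i)) h).mux (f i) (.fconst a 0)).size + 1 := by
  induction n with
  | zero => rfl
  | succ n ih =>
    have hmux (c : Circ a .bit) (f g : Circ a .fld) :
        (c.mux f g).size + 1 = (c.mux f (.fconst a 0)).size + g.size := by
      simp only [mux, add, mul, ofBit, not, size]
      ring
    have hsucc : (firstLog h f).size + 1 = _ :=
      hmux (eqG ((ggen a).power (f 0)) h) (f 0) (firstLog h fun i => f i.succ)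
    have hih := ih fun i => f i.succ
    rw [Fin.sum_univ_succ]
    omega

end Size

end Circ

/-! ### Circuits of polynomial size -/

/-- The circuits `f κ i` have size polynomial in `κ`, uniformly in the further index `i`. -/
def PolySize {ι : ℕ → Type} {a b : ℕ → Ty} (f : ∀ κ, ι κ → Circ (a κ) (b κ)) : Prop :=
  ∃ s : ℕ → ℕ, PolyBounded s ∧ ∀ κ i, (f κ i).size ≤ s κ

namespace PolySize

variable {ι : ℕ → Type} {a b c : ℕ → Ty} {n nb : ℕ → ℕ}

theorem of_polyBounded {f : ∀ κ, Circ (a κ) (b κ)} (hf : PolyBounded fun κ => (f κ).size) :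
    PolySize fun κ (_ : ι κ) => f κ :=
  ⟨_, hf, fun _ _ => le_rfl⟩

theorem polyBounded {f : ∀ κ, Circ (a κ) (b κ)} (hf : PolySize fun κ (_ : Unit) => f κ) :
    PolyBounded fun κ => (f κ).size := by
  obtain ⟨s, ⟨p, hp⟩, hs⟩ := hf
  exact ⟨p, fun κ => (hs κ ()).trans (hp κ)⟩

theorem of_size_eq_one {f : ∀ κ, ι κ → Circ (a κ) (b κ)} (hf : ∀ κ i, (f κ i).size = 1) :
    PolySize f :=
  ⟨_, .const 1, fun κ i => (hf κ i).le⟩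

theorem comp {f : ∀ κ, ι κ → Circ (a κ) (b κ)} {g : ∀ κ, ι κ → Circ (b κ) (c κ)}
    (hf : PolySize f) (hg : PolySize g) : PolySize fun κ i => .comp (f κ i) (g κ i) := by
  obtain ⟨s, hs, hfs⟩ := hf
  obtain ⟨t, ht, hgt⟩ := hg
  exact ⟨_, hs.add ht, fun κ i => add_le_add (hfs κ i) (hgt κ i)⟩

theorem pair {f : ∀ κ, ι κ → Circ (a κ) (b κ)} {g : ∀ κ, ι κ → Circ (a κ) (c κ)}
    (hf : PolySize f) (hg : PolySize g) : PolySize fun κ i => .pair (f κ i) (g κ i) := by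
  obtain ⟨s, hs, hfs⟩ := hf
  obtain ⟨t, ht, hgt⟩ := hg
  exact ⟨_, (hs.add ht).add (.const 1),
    fun κ i => Nat.add_le_add_right (add_le_add (hfs κ i) (hgt κ i)) 1⟩

theorem of_size_le_sum {m : ℕ} (hn : PolyBounded n) {f : ∀ κ, ι κ → Circ (a κ) (b κ)}
    {g : ∀ κ, ι κ → Fin (n κ) → Circ (a κ) (c κ)}
    (hg : PolySize fun κ (p : ι κ × Fin (n κ)) => g κ p.1 p.2) {d : ℕ}
    (hf : ∀ κ i, (f κ i).size ≤ ∑ j, ((g κ i j).size + d) + m) : PolySize f := by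
  obtain ⟨s, hs, hgs⟩ := hg
  refine ⟨_, (hn.mul (hs.add (.const d))).add (.const m), fun κ i => ?_⟩
  refine (hf κ i).trans (Nat.add_le_add_right ?_ m)
  simpa using Finset.sum_le_card_nsmul Finset.univ _ (s κ + d)
    fun j _ => Nat.add_le_add_right (hgs κ (i, j)) d

theorem tup (hn : PolyBounded n) {f : ∀ κ, ι κ → Fin (n κ) → Circ (a κ) (b κ)}
    (hf : PolySize fun κ (p : ι κ × Fin (n κ)) => f κ p.1 p.2) :
    PolySize fun κ i => .tup (f κ i) :=
  of_size_le_sum (m := 1) (d := 0) hn hf fun _ _ => le_rfl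

theorem ite {p : ∀ κ, ι κ → Prop} [∀ κ i, Decidable (p κ i)]
    {f g : ∀ κ, ι κ → Circ (a κ) (b κ)} (hf : PolySize f) (hg : PolySize g) :
    PolySize fun κ i => if p κ i then f κ i else g κ i := by
  obtain ⟨s, hs, hfs⟩ := hf
  obtain ⟨t, ht, hgt⟩ := hg
  refine ⟨_, hs.add ht, fun κ i => ?_⟩
  beta_reduce
  split_ifs
  · exact (hfs κ i).trans le_self_add
  · exact (hgt κ i).trans le_add_self

section Combinators

variable {f g : ∀ κ, ι κ → Circ (a κ) .fld} {u : ∀ κ, ι κ → Circ (a κ) .bit}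
  {x y h : ∀ κ, ι κ → Circ (a κ) .grp}

theorem entry {f : ∀ κ, ι κ → Circ (a κ) (.pow (b κ) (n κ))} {i : ∀ κ, ι κ → Fin (n κ)}
    (hf : PolySize f) : PolySize fun κ p => (f κ p).entry (i κ p) :=
  hf.comp (of_size_eq_one fun _ _ => rfl)

theorem entry₂ {f : ∀ κ, ι κ → Circ (a κ) (.pow (.pow (b κ) (n κ)) (nb κ))}
    {i : ∀ κ, ι κ → Fin (nb κ)} {j : ∀ κ, ι κ → Fin (n κ)} (hf : PolySize f) :
    PolySize fun κ p => (f κ p).entry₂ (i κ p) (j κ p) :=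
  hf.entry.entry

theorem left {f : ∀ κ, ι κ → Circ (a κ) (.prod (b κ) (c κ))} (hf : PolySize f) :
    PolySize fun κ i => (f κ i).left :=
  hf.comp (of_size_eq_one fun _ _ => rfl)

theorem right {f : ∀ κ, ι κ → Circ (a κ) (.prod (b κ) (c κ))} (hf : PolySize f) :
    PolySize fun κ i => (f κ i).right :=
  hf.comp (of_size_eq_one fun _ _ => rfl)

theorem add (hf : PolySize f) (hg : PolySize g) : PolySize fun κ i => (f κ i).add (g κ i) :=
  (hf.pair hg).comp (of_size_eq_one fun _ _ => rfl)

theorem mul (hf : PolySize f) (hg : PolySize g) : PolySize fun κ i => (f κ i).mul (g κ i) :=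
  (hf.pair hg).comp (of_size_eq_one fun _ _ => rfl)

theorem sub (hf : PolySize f) (hg : PolySize g) : PolySize fun κ i => (f κ i).sub (g κ i) :=
  hf.add (mul (of_size_eq_one fun _ _ => rfl) hg)

theorem inv (hf : PolySize f) : PolySize fun κ i => (f κ i).inv :=
  hf.comp (of_size_eq_one fun _ _ => rfl)

theorem ofBit (hu : PolySize u) : PolySize fun κ i => (u κ i).ofBit :=
  hu.comp (of_size_eq_one fun _ _ => rfl)

theorem not (hu : PolySize u) : PolySize fun κ i => (u κ i).not :=
  hu.comp (of_size_eq_one fun _ _ => rfl)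

theorem and {u' : ∀ κ, ι κ → Circ (a κ) .bit} (hu : PolySize u) (hu' : PolySize u') :
    PolySize fun κ i => (u κ i).and (u' κ i) :=
  (hu.pair hu').comp (of_size_eq_one fun _ _ => rfl)

theorem mux (hu : PolySize u) (hf : PolySize f) (hg : PolySize g) :
    PolySize fun κ i => (u κ i).mux (f κ i) (g κ i) :=
  (hu.ofBit.mul hf).add (hu.not.ofBit.mul hg)

theorem sum (hn : PolyBounded n) {f : ∀ κ, ι κ → Fin (n κ) → Circ (a κ) .fld}
    (hf : PolySize fun κ (p : ι κ × Fin (n κ)) => f κ p.1 p.2) :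
    PolySize fun κ i => Circ.sum (f κ i) :=
  of_size_le_sum hn hf fun _ _ => (Circ.size_sum _).le

theorem sumWhere (hn : PolyBounded n) {u : ∀ κ, ι κ → Fin (n κ) → Circ (a κ) .bit}
    {f : ∀ κ, ι κ → Fin (n κ) → Circ (a κ) .fld}
    (hu : PolySize fun κ (p : ι κ × Fin (n κ)) => u κ p.1 p.2)
    (hf : PolySize fun κ (p : ι κ × Fin (n κ)) => f κ p.1 p.2) :
    PolySize fun κ i => Circ.sumWhere (u κ i) (f κ i) :=
  sum hn (hu.mux hf (of_size_eq_one fun _ _ => rfl))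

theorem times (hx : PolySize x) (hy : PolySize y) : PolySize fun κ i => (x κ i).times (y κ i) :=
  (hx.pair hy).comp (of_size_eq_one fun _ _ => rfl)

theorem power (hx : PolySize x) (hf : PolySize f) : PolySize fun κ i => (x κ i).power (f κ i) :=
  (hx.pair hf).comp (of_size_eq_one fun _ _ => rfl)

theorem one : PolySize fun κ (_ : ι κ) => Circ.one (a κ) :=
  power (of_size_eq_one fun _ _ => rfl) (of_size_eq_one fun _ _ => rfl)

theorem ginv (hx : PolySize x) : PolySize fun κ i => (x κ i).ginv :=
  hx.power (of_size_eq_one fun _ _ => rfl)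

theorem eqG (hx : PolySize x) (hy : PolySize y) : PolySize fun κ i => (x κ i).eqG (y κ i) :=
  (hx.pair hy).comp (of_size_eq_one fun _ _ => rfl)

theorem gmux (hu : PolySize u) (hx : PolySize x) (hy : PolySize y) :
    PolySize fun κ i => (u κ i).gmux (x κ i) (y κ i) :=
  (hx.power hu.ofBit).times (hy.power hu.not.ofBit)

theorem product (hn : PolyBounded n) {f : ∀ κ, ι κ → Fin (n κ) → Circ (a κ) .grp}
    (hf : PolySize fun κ (p : ι κ × Fin (n κ)) => f κ p.1 p.2) :
    PolySize fun κ i => Circ.product (f κ i) :=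
  of_size_le_sum (m := 4) hn hf fun _ _ => (Circ.size_product _).le

theorem productWhere (hn : PolyBounded n) {u : ∀ κ, ι κ → Fin (n κ) → Circ (a κ) .bit}
    {f : ∀ κ, ι κ → Fin (n κ) → Circ (a κ) .grp}
    (hu : PolySize fun κ (p : ι κ × Fin (n κ)) => u κ p.1 p.2)
    (hf : PolySize fun κ (p : ι κ × Fin (n κ)) => f κ p.1 p.2) :
    PolySize fun κ i => Circ.productWhere (u κ i) (f κ i) :=
  product hn (hu.gmux hf one)

theorem commit (hh : PolySize h) (hf : PolySize f) (hg : PolySize g) :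
    PolySize fun κ i => (h κ i).commit (f κ i) (g κ i) :=
  (power (of_size_eq_one fun _ _ => rfl) hf).times (hh.power hg)

theorem flipBit (hu : PolySize u) (hf : PolySize f) :
    PolySize fun κ i => (u κ i).flipBit (f κ i) :=
  hu.mux (sub (of_size_eq_one fun _ _ => rfl) hf) hf

theorem flipRand (hu : PolySize u) (hf : PolySize f) :
    PolySize fun κ i => (u κ i).flipRand (f κ i) :=
  hu.mux (sub (of_size_eq_one fun _ _ => rfl) hf) hf

theorem flipCom (hh : PolySize h) (hu : PolySize u) (hx : PolySize x) :
    PolySize fun κ i => (h κ i).flipCom (u κ i) (x κ i) :=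
  hu.gmux ((hh.commit (of_size_eq_one fun _ _ => rfl) (of_size_eq_one fun _ _ => rfl)).times
    hx.ginv) hx

theorem aggregate (hn : PolyBounded n) (hnb : PolyBounded nb)
    {va : ∀ κ, ι κ → Fin (n κ) → Circ (a κ) .bit} {sh r : ∀ κ, ι κ → Fin (n κ) → Circ (a κ) .fld}
    {v s : ∀ κ, ι κ → Fin (nb κ) → Circ (a κ) .fld} {b : ∀ κ, ι κ → Fin (nb κ) → Circ (a κ) .bit}
    (hva : PolySize fun κ (p : ι κ × Fin (n κ)) => va κ p.1 p.2)
    (hsh : PolySize fun κ (p : ι κ × Fin (n κ)) => sh κ p.1 p.2)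
    (hr : PolySize fun κ (p : ι κ × Fin (n κ)) => r κ p.1 p.2)
    (hv : PolySize fun κ (p : ι κ × Fin (nb κ)) => v κ p.1 p.2)
    (hs : PolySize fun κ (p : ι κ × Fin (nb κ)) => s κ p.1 p.2)
    (hb : PolySize fun κ (p : ι κ × Fin (nb κ)) => b κ p.1 p.2) :
    PolySize fun κ i => .aggregate (va κ i) (sh κ i) (r κ i) (v κ i) (s κ i) (b κ i) :=
  ((sumWhere hn hva hsh).add (sum hnb (hb.flipBit hv))).pair
    ((sumWhere hn hva hr).add (sum hnb (hb.flipRand hs)))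

theorem openingsLog {w w' : ∀ κ, ι κ → Circ (a κ) (.prod .fld .fld)} (hw : PolySize w)
    (hw' : PolySize w') : PolySize fun κ i => (w κ i).openingsLog (w' κ i) :=
  (hw'.left.sub hw.left).mul (hw.right.sub hw'.right).inv

theorem firstLog (hn : PolyBounded n) (hh : PolySize h)
    {f : ∀ κ, ι κ → Fin (n κ) → Circ (a κ) .fld}
    (hf : PolySize fun κ (p : ι κ × Fin (n κ)) => f κ p.1 p.2) :
    PolySize fun κ i => (h κ i).firstLog (f κ i) :=
  have hh' : PolySize fun κ (p : ι κ × Fin (n κ)) => h κ p.1 := hh.imp fun _ hs =>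
    ⟨hs.1, fun κ p => hs.2 κ p.1⟩
  of_size_le_sum (m := 1) (d := 0)
    (g := fun κ i j => (((Circ.ggen (a κ)).power (f κ i j)).eqG (h κ i)).mux (f κ i j)
      (.fconst (a κ) 0)) hn
    (((power (of_size_eq_one fun _ _ => rfl) hf).eqG hh').mux hf (of_size_eq_one fun _ _ => rfl))
    fun _ _ => Circ.size_firstLog_le _ _

end Combinators

end PolySize

/-! ### Reading randomness off a tape -/

section Tape

theorem preservesUniform_precomp {ι κ α : Type*} [Fintype α] [Nonempty α] [Fintype ι] [Fintype κ]
    [DecidableEq ι] [DecidableEq κ] {g : ι → κ} (hg : Function.Injective g) :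
    PreservesUniform fun (f : κ → α) i => f (g i) := by
  classical
  have hsplit := preservesUniform_equiv
    (Equiv.piEquivPiSubtypeProd (fun x => x ∈ Set.range g) fun _ => α)
  have hreindex : PreservesUniform fun (f : {x // x ∈ Set.range g} → α) (i : ι) =>
      f ⟨g i, Set.mem_range_self i⟩ :=
    preservesUniform_equiv (Equiv.arrowCongr (Equiv.ofInjective g hg).symm (Equiv.refl α))
  exact hreindex.comp (preservesUniform_fst.comp hsplit)

/-- The length of a tape that holds bits named by `β` and elements of `ℤ_q` named by `φ`. Bits and
field elements are put at different positions, although a tape would have room for one of each at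
every position. -/
abbrev tapeLength (β φ : Type) [Fintype β] [Fintype φ] : ℕ := Fintype.card (β ⊕ φ)

variable {q : ℕ} {β φ : Type} [Fintype β] [Fintype φ]

/-- The named random bits and field elements on a tape. -/
noncomputable def readTape (t : Tape q (tapeLength β φ)) : (β → Bool) × (φ → ZMod q) :=
  (fun i => t.1 (Fintype.equivFin _ (.inl i)), fun i => t.2 (Fintype.equivFin _ (.inr i)))

theorem preservesUniform_readTape [NeZero q] [DecidableEq β] [DecidableEq φ] :
    PreservesUniform (readTape (q := q) (β := β) (φ := φ)) :=
  (preservesUniform_precomp ((Fintype.equivFin (β ⊕ φ)).injective.comp Sum.inl_injective)).prodMap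
    (preservesUniform_precomp ((Fintype.equivFin (β ⊕ φ)).injective.comp Sum.inr_injective))

namespace Circ

variable {a : Ty}

/-- A named bit of a tape. -/
noncomputable def coinBit (t : Circ a (.tape (tapeLength β φ))) (i : β) : Circ a .bit :=
  t.left.entry (Fintype.equivFin _ (.inl i))

/-- A named field element of a tape. -/
noncomputable def coinFld (t : Circ a (.tape (tapeLength β φ))) (i : φ) : Circ a .fld :=
  t.right.entry (Fintype.equivFin _ (.inr i))

end Circ

namespace PolySize

variable {ι : ℕ → Type} {a : ℕ → Ty} {β φ : ℕ → Type} [∀ κ, Fintype (β κ)] [∀ κ, Fintype (φ κ)]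
  {t : ∀ κ, ι κ → Circ (a κ) (.tape (tapeLength (β κ) (φ κ)))}

theorem coinBit {i : ∀ κ, ι κ → β κ} (ht : PolySize t) :
    PolySize fun κ p => (t κ p).coinBit (i κ p) :=
  ht.left.entry

theorem coinFld {i : ∀ κ, ι κ → φ κ} (ht : PolySize t) :
    PolySize fun κ p => (t κ p).coinFld (i κ p) :=
  ht.right.entry

end PolySize

end Tape

/-! ### The reduction to discrete logarithms -/

section ExecTape

/-- Names for the random bits of an execution: the adversary's coins, the private bits and the
public coins. -/
abbrev ExecBits (nb K m : ℕ) : Type := Fin m ⊕ (Fin K × Fin nb) ⊕ (Fin K × Fin nb)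

/-- Names for the random field elements of an execution: the adversary's coins and the commitment
randomness of the clients and of the provers. -/
abbrev ExecFields (n nb K m : ℕ) : Type := Fin m ⊕ (Fin K × Fin n) ⊕ (Fin K × Fin nb)

/-- The length of a tape with the randomness of an execution. -/
abbrev execLength (n nb K m : ℕ) : ℕ := tapeLength (ExecBits nb K m) (ExecFields n nb K m)

/-- The randomness of an execution from its named bits and field elements. -/
def execOfNamed (q n nb K m : ℕ) :
    (ExecBits nb K m → Bool) × (ExecFields n nb K m → ZMod q) ≃ ExecRand q n nb K m where
  toFun u := ((fun i => u.1 (.inl i), fun i => u.2 (.inl i)), fun k i => u.2 (.inr (.inl (k, i))),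
    fun k j => u.1 (.inr (.inl (k, j))), fun k j => u.2 (.inr (.inr (k, j))),
    fun k j => u.1 (.inr (.inr (k, j))))
  invFun w := (Sum.elim w.1.1 (Sum.elim (fun p => w.2.v p.1 p.2) fun p => w.2.b p.1 p.2),
    Sum.elim w.1.2 (Sum.elim (fun p => w.2.r p.1 p.2) fun p => w.2.s p.1 p.2))
  left_inv u := Prod.ext (by ext (_ | _ | _) <;> rfl) (by ext (_ | _ | _) <;> rfl)
  right_inv _ := rfl

variable {q n nb K m : ℕ}

/-- The randomness of an execution, read off a tape. -/
noncomputable def execOfTape (t : Tape q (execLength n nb K m)) : ExecRand q n nb K m :=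
  execOfNamed q n nb K m (readTape t)

theorem preservesUniform_execOfTape [NeZero q] :
    PreservesUniform (execOfTape (q := q) (n := n) (nb := nb) (K := K) (m := m)) :=
  (preservesUniform_equiv (execOfNamed q n nb K m)).comp preservesUniform_readTape

theorem PolyBounded.execLength {n nb K m : ℕ → ℕ} (hn : PolyBounded n) (hnb : PolyBounded nb)
    (hK : PolyBounded K) (hm : PolyBounded m) :
    PolyBounded fun κ => execLength (n κ) (nb κ) (K κ) (m κ) := by
  simp only [Fintype.card_sum, Fintype.card_prod, Fintype.card_fin]
  exact (hm.add ((hK.mul hnb).add (hK.mul hnb))).add (hm.add ((hK.mul hn).add (hK.mul hnb)))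

end ExecTape

namespace ProverAttack

section Circuits

variable {n nb K m l : ℕ} {q : ℕ}

/-- The input of the reduction: a tape and the group element `h`, whose logarithm it computes. -/
abbrev Input (n nb K m : ℕ) : Ty := .prod (.tape (execLength n nb K m)) .grp

variable (n nb K m) in
/-- The random tape of the reduction. -/
def tape : Circ (Input n nb K m) (.tape (execLength n nb K m)) := .fst _ _

variable (n nb K m) in
/-- The second generator `h`. -/
def secondGen : Circ (Input n nb K m) .grp := .snd _ _

/-- The commitment randomness of client `i` for prover `k`. -/
noncomputable def clientRand (k : Fin K) (i : Fin n) : Circ (Input n nb K m) .fld :=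
  (tape n nb K m).coinFld (.inr (.inl (k, i)))

/-- The private bit `v_{j,k}` of an honest prover. -/
noncomputable def privateBit (k : Fin K) (j : Fin nb) : Circ (Input n nb K m) .fld :=
  ((tape n nb K m).coinBit (.inr (.inl (k, j)))).ofBit

/-- The commitment randomness `s_{j,k}` of an honest prover. -/
noncomputable def bitRand (k : Fin K) (j : Fin nb) : Circ (Input n nb K m) .fld :=
  (tape n nb K m).coinFld (.inr (.inr (k, j)))

/-- The public coin `b_{j,k}`. -/
noncomputable def publicCoin (k : Fin K) (j : Fin nb) : Circ (Input n nb K m) .bit :=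
  (tape n nb K m).coinBit (.inr (.inr (k, j)))

variable (A : ProverAttack n nb K m l) (I : Finset (Fin K)) (aux : Fin l → Bool)
  (x : Fin n → ZMod q) (sh : Fin K → Fin n → ZMod q)

/-- A circuit for `startView`. -/
noncomputable def startCirc : Circ (Input n nb K m) (.start n K m l) :=
  .pair (.pair (.tup fun i => (tape n nb K m).coinBit (.inl i))
      (.tup fun i => (tape n nb K m).coinFld (.inl i)))
    (.pair (.tup fun i => .bconst _ (aux i)) (.pair (secondGen n nb K m)
      (.pair (.tup fun k => .tup fun i => if k ∈ I then .pair (.const _ (sh k i)) (clientRand k i)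
          else .pair (.fconst _ 0) (.fconst _ 0))
        (.pair (.tup fun k => .tup fun i =>
            (secondGen n nb K m).commit (.const _ (sh k i)) (clientRand k i))
          (.tup fun i => .bconst _ (decide (i ∈ legal x)))))))

/-- A circuit for `honestComs`. -/
noncomputable def honestComsCirc : Circ (Input n nb K m) (.pow (.pow .grp nb) K) :=
  .tup fun k => .tup fun j => if k ∈ I then .one _
    else (secondGen n nb K m).commit (privateBit k j) (bitRand k j)

/-- A circuit for `commitView`. -/
noncomputable def viewCirc :
    Circ (Input n nb K m) (.prod (.start n K m l) (.pow (.pow .grp nb) K)) :=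
  .pair (startCirc I aux x sh) (honestComsCirc I)

/-- The part of the commitments and openings chosen by `A` that belongs to `k` and `j`. -/
noncomputable def openingCirc (k : Fin K) (j : Fin nb) :
    Circ (Input n nb K m) (.prod .fld .fld) :=
  (Circ.entry₂ (.comp (viewCirc I aux x sh) A.commit) k j).right

/-- A circuit for `aggregate` for prover `k`, with openings `v`, `s` of its commitments. -/
noncomputable def aggregateCirc (k : Fin K) (v s : Fin nb → Circ (Input n nb K m) .fld) :
    Circ (Input n nb K m) (.prod .fld .fld) :=
  .aggregate (fun i => .bconst _ (decide (i ∈ legal x))) (fun i => .const _ (sh k i))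
    (clientRand k) v s (publicCoin k)

/-- The final messages of the honest provers, and zero for `k ∈ I`. -/
noncomputable def honestCirc : Circ (Input n nb K m) (.pow (.prod .fld .fld) K) :=
  .tup fun k => if k ∈ I then .pair (.fconst _ 0) (.fconst _ 0)
    else aggregateCirc x sh k (privateBit k) (bitRand k)

/-- The final messages chosen by `A`. -/
noncomputable def respondCirc : Circ (Input n nb K m) (.pow (.prod .fld .fld) K) :=
  .comp (.pair (viewCirc I aux x sh)
    (.pair (.tup fun k => .tup fun j => publicCoin k j) (honestCirc I x sh))) A.respond

/-- The logarithm that the openings of the commitments of prover `k` and its final message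
reveal. -/
noncomputable def candidateCirc (k : Fin K) : Circ (Input n nb K m) .fld :=
  .openingsLog (aggregateCirc x sh k (fun j => (openingCirc A I aux x sh k j).left)
    fun j => (openingCirc A I aux x sh k j).right) ((respondCirc A I aux x sh).entry k)

/-- The discrete logarithm of `h`, extracted from the attack. -/
noncomputable def solveCirc : Circ (Input n nb K m) .fld :=
  .firstLog (secondGen n nb K m) (candidateCirc A I aux x sh)

end Circuits

section Eval

variable {n nb K m l : ℕ} {q : ℕ} (A : ProverAttack n nb K m l) (I : Finset (Fin K))
  (aux : Fin l → Bool) {x : Fin n → ZMod q} {sh : Fin K → Fin n → ZMod q} (P : PrimeGroup q)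
  (t : Tape q (execLength n nb K m)) (h : P.carrier)

theorem eval_honestComsCirc :
    (honestComsCirc I).eval P (t, h) =
      honestComs P h I (execOfTape t).2.v (execOfTape t).2.s := by
  funext k j
  simp only [honestComsCirc, honestComs, Circ.eval_tup]
  split_ifs
  · exact Circ.eval_one P _
  · rfl

variable [NeZero q]

theorem eval_startCirc (hsh : ∀ i, ∑ k, sh k i = x i) :
    (startCirc I aux x sh).eval P (t, h) =
      startView P h I aux x sh (execOfTape t).2.r (execOfTape t).1 := by
  have hshares : (fun k i => if k ∈ I then (sh k i, (execOfTape t).2.r k i) else (0, 0)) =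
      fun k i => (if k ∈ I then Circ.pair (.const _ (sh k i)) (clientRand k i)
          else .pair (.fconst _ 0) (.fconst _ 0)).eval P (t, h) := by
    funext k i
    split_ifs
    · simp
      rfl
    · simp
  have hvalid : valid P h x sh (execOfTape t).2.r = fun i => decide (i ∈ legal x) := by
    funext i
    rw [Bool.eq_iff_iff, valid_eq_true hsh, decide_eq_true_iff]
    simp [legal]
  simp only [startView, hshares, hvalid, startCirc, Circ.eval_pair, Circ.eval_tup,
    Circ.eval_commit, Circ.eval_const, Circ.eval_bconst]
  rfl

theorem eval_viewCirc (hsh : ∀ i, ∑ k, sh k i = x i) :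
    (viewCirc I aux x sh).eval P (t, h) = commitView P h I aux x sh (execOfTape t) :=
  Prod.ext (eval_startCirc I aux P t h hsh) (eval_honestComsCirc I P t h)

theorem eval_openingCirc (hsh : ∀ i, ∑ k, sh k i = x i) {k : Fin K} (hk : k ∈ I) (j : Fin nb) :
    (openingCirc A I aux x sh k j).eval P (t, h) =
      proverOpening P h A I aux x sh (execOfTape t) k j := by
  rw [openingCirc, Circ.eval_right, Circ.eval_entry₂, Circ.eval_comp, eval_viewCirc I aux P t h hsh,
    proverOpening, if_pos hk]

theorem eval_aggregateCirc (k : Fin K) (v s : Fin nb → Circ (Input n nb K m) .fld) :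
    (aggregateCirc x sh k v s).eval P (t, h) =
      aggregate (legal x) (sh k) ((execOfTape t).2.r k) (fun j => (v j).eval P (t, h))
        (fun j => (s j).eval P (t, h)) ((execOfTape t).2.b k) := by
  simp [aggregateCirc]
  rfl

theorem eval_honestCirc (hsh : ∀ i, ∑ k, sh k i = x i) :
    (honestCirc I x sh).eval P (t, h) =
      fun k => if k ∈ I then (0, 0) else honestResponse P h x sh (execOfTape t).2 k := by
  funext k
  rw [honestCirc, Circ.eval_tup]
  beta_reduce
  split_ifs
  · simp
  · rw [eval_aggregateCirc, honestResponse_eq_aggregate hsh]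
    rfl

theorem eval_respondCirc (hsh : ∀ i, ∑ k, sh k i = x i) {k : Fin K} (hk : k ∈ I) :
    (respondCirc A I aux x sh).eval P (t, h) k =
      proverResponse P h A I aux x sh (execOfTape t) k := by
  rw [respondCirc, Circ.eval_comp, Circ.eval_pair, Circ.eval_pair, eval_viewCirc I aux P t h hsh,
    eval_honestCirc I P t h hsh, proverResponse, if_pos hk]
  rfl

variable [Fact q.Prime]

theorem eval_candidateCirc (hsh : ∀ i, ∑ k, sh k i = x i) {k : Fin K} (hk : k ∈ I) :
    (candidateCirc A I aux x sh k).eval P (t, h) =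
      openingsLog (expectedResponse P h A I aux x sh (execOfTape t) k)
        (proverResponse P h A I aux x sh (execOfTape t) k) := by
  rw [candidateCirc, Circ.eval_openingsLog, Circ.eval_entry, eval_respondCirc A I aux P t h hsh hk,
    eval_aggregateCirc]
  simp only [Circ.eval_left, Circ.eval_right, eval_openingCirc A I aux P t h hsh hk]
  rfl

/-- The case `z = 0` is the default answer of the circuit; it makes the reduction lose nothing in
passing from uniform units, the logarithms of `h`, to uniform elements of `ℤ_q`. -/
theorem eval_solveCirc (hsh : ∀ i, ∑ k, sh k i = x i) {z : ZMod q}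
    (hz : z = 0 ∨ (attackOutcome P (P.exp z) A I aux x sh (execOfTape t)).accept = true ∧
      (attackOutcome P (P.exp z) A I aux x sh (execOfTape t)).y ≠
        (attackOutcome P (P.exp z) A I aux x sh (execOfTape t)).ideal) :
    (solveCirc A I aux x sh).eval P (t, P.exp z) = z := by
  refine Circ.eval_firstLog_eq P _ rfl (hz.imp_right fun hcheat => ?_)
  obtain ⟨k, hk, hlog⟩ := exists_openingsLog_eq_of_cheat hsh hcheat.1 hcheat.2
  exact ⟨k, (eval_candidateCirc A I aux P t _ hsh hk).trans hlog⟩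

end Eval

section Size

variable {ι : ℕ → Type} {n nb K m l q : ℕ → ℕ}
  {A : ∀ κ, ProverAttack (n κ) (nb κ) (K κ) (m κ) (l κ)}
  {I : ∀ κ, Finset (Fin (K κ))} {aux : ∀ κ, Fin (l κ) → Bool} {x : ∀ κ, Fin (n κ) → ZMod (q κ)}
  {sh : ∀ κ, Fin (K κ) → Fin (n κ) → ZMod (q κ)}

theorem polySize_tape : PolySize fun κ (_ : ι κ) => tape (n κ) (nb κ) (K κ) (m κ) :=
  .of_size_eq_one fun _ _ => rfl

theorem polySize_secondGen : PolySize fun κ (_ : ι κ) => secondGen (n κ) (nb κ) (K κ) (m κ) :=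
  .of_size_eq_one fun _ _ => rfl

theorem polySize_clientRand {k : ∀ κ, ι κ → Fin (K κ)} {i : ∀ κ, ι κ → Fin (n κ)} :
    PolySize fun κ p => clientRand (nb := nb κ) (m := m κ) (k κ p) (i κ p) :=
  polySize_tape.coinFld

theorem polySize_privateBit {k : ∀ κ, ι κ → Fin (K κ)} {j : ∀ κ, ι κ → Fin (nb κ)} :
    PolySize fun κ p => privateBit (n := n κ) (m := m κ) (k κ p) (j κ p) :=
  polySize_tape.coinBit.ofBit

theorem polySize_bitRand {k : ∀ κ, ι κ → Fin (K κ)} {j : ∀ κ, ι κ → Fin (nb κ)} :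
    PolySize fun κ p => bitRand (n := n κ) (m := m κ) (k κ p) (j κ p) :=
  polySize_tape.coinFld

theorem polySize_publicCoin {k : ∀ κ, ι κ → Fin (K κ)} {j : ∀ κ, ι κ → Fin (nb κ)} :
    PolySize fun κ p => publicCoin (n := n κ) (m := m κ) (k κ p) (j κ p) :=
  polySize_tape.coinBit

variable (hn : PolyBounded n) (hnb : PolyBounded nb) (hK : PolyBounded K) (hm : PolyBounded m)
  (hl : PolyBounded l)

include hn hK hm hl in
theorem polySize_startCirc :
    PolySize fun κ (_ : ι κ) => startCirc (nb := nb κ) (m := m κ) (I κ) (aux κ) (x κ) (sh κ) :=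
  ((PolySize.tup hm polySize_tape.coinBit).pair (.tup hm polySize_tape.coinFld)).pair
    (.pair (.tup hl (.of_size_eq_one fun _ _ => rfl)) (polySize_secondGen.pair
      (.pair (.tup hK (.tup hn (.ite (.pair (.of_size_eq_one fun _ _ => rfl) polySize_clientRand)
          (.pair (.of_size_eq_one fun _ _ => rfl) (.of_size_eq_one fun _ _ => rfl)))))
        (.pair (.tup hK (.tup hn (polySize_secondGen.commit (.of_size_eq_one fun _ _ => rfl)
            polySize_clientRand)))
          (.tup hn (.of_size_eq_one fun _ _ => rfl))))))

include hnb hK in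
theorem polySize_honestComsCirc :
    PolySize fun κ (_ : ι κ) => honestComsCirc (n := n κ) (nb := nb κ) (m := m κ) (I κ) :=
  .tup hK (.tup hnb (.ite .one (polySize_secondGen.commit polySize_privateBit polySize_bitRand)))

include hn hnb hK hm hl in
theorem polySize_viewCirc :
    PolySize fun κ (_ : ι κ) => viewCirc (nb := nb κ) (m := m κ) (I κ) (aux κ) (x κ) (sh κ) :=
  (polySize_startCirc hn hK hm hl).pair (polySize_honestComsCirc hnb hK)

include hn hnb hK hm hl in
theorem polySize_openingCirc (hA : PolyBounded fun κ => (A κ).commit.size)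
    {k : ∀ κ, ι κ → Fin (K κ)} {j : ∀ κ, ι κ → Fin (nb κ)} :
    PolySize fun κ p => openingCirc (A κ) (I κ) (aux κ) (x κ) (sh κ) (k κ p) (j κ p) :=
  ((polySize_viewCirc hn hnb hK hm hl).comp (.of_polyBounded hA)).entry₂.right

include hn hnb in
theorem polySize_aggregateCirc {k : ∀ κ, ι κ → Fin (K κ)}
    {v s : ∀ κ, ι κ → Fin (nb κ) → Circ (Input (n κ) (nb κ) (K κ) (m κ)) .fld}
    (hv : PolySize fun κ (p : ι κ × Fin (nb κ)) => v κ p.1 p.2)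
    (hs : PolySize fun κ (p : ι κ × Fin (nb κ)) => s κ p.1 p.2) :
    PolySize fun κ p => aggregateCirc (x κ) (sh κ) (k κ p) (v κ p) (s κ p) :=
  .aggregate hn hnb (.of_size_eq_one fun _ _ => rfl) (.of_size_eq_one fun _ _ => rfl)
    polySize_clientRand hv hs polySize_publicCoin

include hn hnb hK in
theorem polySize_honestCirc :
    PolySize fun κ (_ : ι κ) => honestCirc (nb := nb κ) (m := m κ) (I κ) (x κ) (sh κ) :=
  .tup hK (.ite (.pair (.of_size_eq_one fun _ _ => rfl) (.of_size_eq_one fun _ _ => rfl))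
    (polySize_aggregateCirc hn hnb polySize_privateBit polySize_bitRand))

include hn hnb hK hm hl in
theorem polySize_respondCirc (hA : PolyBounded fun κ => (A κ).respond.size) :
    PolySize fun κ (_ : ι κ) => respondCirc (A κ) (I κ) (aux κ) (x κ) (sh κ) :=
  have hcoins : PolySize fun κ (p : (ι κ × Fin (K κ)) × Fin (nb κ)) =>
      publicCoin (n := n κ) (m := m κ) p.1.2 p.2 := polySize_publicCoin
  ((polySize_viewCirc hn hnb hK hm hl).pair
    (.pair (.tup hK (.tup hnb hcoins)) (polySize_honestCirc hn hnb hK))).comp (.of_polyBounded hA)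

include hn hnb hK hm hl in
theorem polySize_solveCirc (hcommit : PolyBounded fun κ => (A κ).commit.size)
    (hrespond : PolyBounded fun κ => (A κ).respond.size) :
    PolySize fun κ (_ : ι κ) => solveCirc (A κ) (I κ) (aux κ) (x κ) (sh κ) :=
  have hopen := fun {ι} {k j} =>
    polySize_openingCirc (ι := ι) (I := I) (aux := aux) (x := x) (sh := sh) (k := k) (j := j)
      hn hnb hK hm hl hcommit
  .firstLog hK polySize_secondGen (.openingsLog (polySize_aggregateCirc hn hnb hopen.left
    hopen.right) (polySize_respondCirc hn hnb hK hm hl hrespond).entry)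

end Size

end ProverAttack

/-- The adversary against discrete logarithms that runs `A` and outputs the logarithm revealed by
two openings of one commitment. -/
noncomputable def ProverAdversary.reduction {N : Sizes} (A : ProverAdversary N) {q : ℕ → ℕ}
    (I : ∀ κ, Finset (Fin (N.K κ))) (aux : ∀ κ, Fin (A.auxLen κ) → Bool)
    (x : ∀ κ, Fin (N.n κ) → ZMod (q κ)) (sh : ∀ κ, Fin (N.K κ) → Fin (N.n κ) → ZMod (q κ)) :
    DLAdversary where
  coins κ := execLength (N.n κ) (N.nb κ) (N.K κ) (A.coins κ)
  solve κ := (A.alg κ).solveCirc (I κ) (aux κ) (x κ) (sh κ)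
  coins_poly := .execLength N.n_poly N.nb_poly N.K_poly A.coins_poly
  solve_poly := (ProverAttack.polySize_solveCirc N.n_poly N.nb_poly N.K_poly A.coins_poly
    A.auxLen_poly A.commit_poly A.respond_poly).polyBounded

section Cheat

variable (S : GroupGen) {N : Sizes} (A : ProverAdversary N) (I : ∀ κ, Finset (Fin (N.K κ)))
  (aux : ∀ κ, Fin (A.auxLen κ) → Bool) {x : ∀ κ, Fin (N.n κ) → ZMod (S.q κ)}
  {sh : ∀ κ, Fin (N.K κ) → Fin (N.n κ) → ZMod (S.q κ)}

theorem cheatProb_le (hsh : ∀ κ i, ∑ k, sh κ k i = x κ i) (κ : ℕ) :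
    cheatProb S A κ (I κ) (aux κ) (x κ) (sh κ) ≤ dlAdv S (A.reduction I aux x sh) κ := by
  rw [cheatProb, attackExp, dlAdv, dlGame, GroupGen.setup, PMF.bind_bind, PMF.map_bind,
    PMF.bind_apply, PMF.bind_apply]
  refine ENNReal.tsum_le_tsum fun ω => mul_le_mul_right ?_ _
  rw [PMF.bind_map, PMF.map_bind]
  simp only [Function.comp_def, PMF.map_comp,
    ← (preservesUniform_execOfTape (q := S.q κ) (n := N.n κ) (nb := N.nb κ) (K := N.K κ)
      (m := A.coins κ)).map_comp]
  let cheats (u : (ZMod (S.q κ))ˣ × Tape (S.q κ) ((A.reduction I aux x sh).coins κ)) : Bool :=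
    let o := attackOutcome (S.grp κ ω) ((S.grp κ ω).exp u.1) (A.alg κ) (I κ) (aux κ) (x κ) (sh κ)
      (execOfTape u.2)
    o.accept && decide (o.y ≠ o.ideal)
  refine (congrArg (· true) (uniform_map_prod cheats)).symm.trans_le ?_
  refine uniform_map_true_le_of_injective
    (i := Prod.map (Units.val : (ZMod (S.q κ))ˣ → ZMod (S.q κ)) id)
    (Prod.map_injective.2 ⟨Units.val_injective, Function.injective_id⟩) (fun u hu => ?_)
    fun u hu => ?_
  · have hu0 : u.1 = 0 := by
      by_contra hne
      exact hu ⟨(Units.mk0 u.1 hne, u.2), rfl⟩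
    exact decide_eq_true ((A.alg κ).eval_solveCirc (I κ) (aux κ) _ u.2 (hsh κ) (.inl hu0))
  · rw [Bool.and_eq_true, decide_eq_true_eq] at hu
    exact decide_eq_true ((A.alg κ).eval_solveCirc (I κ) (aux κ) _ u.2 (hsh κ) (.inr hu))

theorem negligible_cheatProb (hsh : ∀ κ i, ∑ k, sh κ k i = x κ i) (hDL : DLHard S) :
    Negligible fun κ => (cheatProb S A κ (I κ) (aux κ) (x κ) (sh κ)).toReal := by
  refine (hDL (A.reduction I aux x sh)).trans_abs_le fun κ => ?_
  rw [abs_of_nonneg ENNReal.toReal_nonneg, abs_of_nonneg ENNReal.toReal_nonneg]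
  exact ENNReal.toReal_mono (PMF.apply_ne_top _ _) (cheatProb_le S A I aux hsh κ)

end Cheat

/-! ### The simulator -/

section SimTape

/-- Names for the random field elements of the simulator: one for every commitment to a private
bit and one for every prover. -/
abbrev SimFields (nb K : ℕ) : Type := (Fin K × Fin nb) ⊕ Fin K

/-- The number of coins of the simulator. -/
abbrev simLength (nb K : ℕ) : ℕ := tapeLength (Fin K × Fin nb) (SimFields nb K)

/-- The randomness of the simulator. -/
abbrev SimRand (q nb K : ℕ) : Type :=
  (Fin K → Fin nb → Bool) × (Fin K → Fin nb → ZMod q) × (Fin K → ZMod q)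

namespace SimRand

variable {q nb K : ℕ}

/-- The public coins. -/
abbrev b (u : SimRand q nb K) : Fin K → Fin nb → Bool := u.1

/-- The randomness of the commitments to the flipped bits. -/
abbrev w (u : SimRand q nb K) : Fin K → Fin nb → ZMod q := u.2.1

/-- The uniform first components of final messages. -/
abbrev e (u : SimRand q nb K) : Fin K → ZMod q := u.2.2

end SimRand

variable (q nb K : ℕ) in
/-- The randomness of the simulator from its named bits and field elements. -/
def simOfNamed : (Fin K × Fin nb → Bool) × (SimFields nb K → ZMod q) ≃ SimRand q nb K :=
  (Equiv.curry ..).prodCongr ((Equiv.sumArrowEquivProdArrow ..).trans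
    ((Equiv.curry ..).prodCongr (Equiv.refl _)))

variable {q nb K : ℕ}

/-- The randomness of the simulator, read off a tape. -/
noncomputable def simOfTape (t : Tape q (simLength nb K)) : SimRand q nb K :=
  simOfNamed q nb K (readTape t)

theorem preservesUniform_simOfTape [NeZero q] :
    PreservesUniform (simOfTape (q := q) (nb := nb) (K := K)) :=
  (preservesUniform_equiv (simOfNamed q nb K)).comp preservesUniform_readTape

theorem PolyBounded.simLength {nb K : ℕ → ℕ} (hnb : PolyBounded nb) (hK : PolyBounded K) :
    PolyBounded fun κ => simLength (nb κ) (K κ) := by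
  simp only [Fintype.card_sum, Fintype.card_prod, Fintype.card_fin]
  exact (hK.mul hnb).add ((hK.mul hnb).add hK)

end SimTape

section Simulated

variable {q : ℕ} (P : PrimeGroup q) {n nb K m l : ℕ} (A : VerifierAttack n nb K m l)
  (I : Finset (Fin K)) (k₀ : Fin K) (start : (Ty.start n K m l).El P)

/-- The answers of the bit proof oracle, if the honest provers hold openings of the commitments
`c'` to bits. -/
noncomputable def bitProofAnswers (c' : Fin K → Fin nb → P.carrier) (k : Fin K) (j : Fin nb) :
    Bool :=
  if k ∈ I then false
  else open Classical in decide (A.submit.eval P (start, c') k j = c' k j)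

/-- Whether the adversary goes on with prover `k`. -/
noncomputable def goesOn (c' : Fin K → Fin nb → P.carrier) (k : Fin K) : Bool :=
  A.proceed.eval P ((start, c'), bitProofAnswers P A I start c') k

/-- What is received after the start, as a function of the commitments, the public coins and the
final messages of the honest provers. -/
noncomputable def receivedView (c' : Fin K → Fin nb → P.carrier) (b : Fin K → Fin nb → Bool)
    (resp : Fin K → ZMod q × ZMod q) : (Ty.received nb K).El P :=
  (c', bitProofAnswers P A I start c',
    fun k j => if k ∈ I ∨ goesOn P A I start c' k = true then b k j else false,
    fun k => if k ∉ I ∧ goesOn P A I start c' k = true then resp k else (0, 0))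

/-- The simulated first components of the final messages: uniform values, except that the one of
the honest prover `k₀` makes the published value equal to `y`. -/
def simValue (e : Fin K → ZMod q) (y : ZMod q) (Δ : Fin K → ZMod q) (k : Fin K) : ZMod q :=
  if k ∈ I then 0
  else if k = k₀ then y - ∑ k' ∈ I, Δ k' - ∑ k' ∈ (insert k₀ I)ᶜ, e k'
  else e k

variable {P} in
/-- The simulated commitment to a flipped bit. The first one is chosen such that the product of all
commitments of prover `k` commits to `Y`. -/
noncomputable def simFlippedCom (Y : ZMod q) (w : Fin nb → ZMod q) (k : Fin K) (j : Fin nb) :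
    P.carrier :=
  if j.val = 0 then
    com P start.2.2.1 Y (w j) * (∏ i with start.2.2.2.2.2 i = true, start.2.2.2.2.1 k i)⁻¹
  else com P start.2.2.1 0 (w j)

variable {P} in
/-- The simulated commitments of the honest provers, for final messages with first components
`Y`, public coins `b`, and randomness `w` of the commitments to the flipped bits. -/
noncomputable def simComs (Y : Fin K → ZMod q) (b : Fin K → Fin nb → Bool)
    (w : Fin K → Fin nb → ZMod q) (k : Fin K) (j : Fin nb) : P.carrier :=
  if k ∈ I then 1 else flipCom P start.2.2.1 (b k j) (simFlippedCom start (Y k) (w k) k j)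

/-- The simulated view after the start, for final messages with first components `Y`. -/
noncomputable def equivocatedView (Y : Fin K → ZMod q) (b : Fin K → Fin nb → Bool)
    (w : Fin K → Fin nb → ZMod q) : (Ty.received nb K).El P :=
  receivedView P A I start (simComs I start Y b w) b fun k => (Y k, ∑ j, w k j)

/-- The simulated view after the start, given the public output `y` and noise values `Δ`. -/
noncomputable def simReceived (u : SimRand q nb K) (y : ZMod q) (Δ : Fin K → ZMod q) :
    (Ty.received nb K).El P :=
  equivocatedView P A I start (simValue I k₀ u.e y Δ) u.b u.w

end Simulated

namespace VerifierAttack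

section Circuits

variable {n nb K m l : ℕ}

/-- The input of the output circuit of the simulator. -/
abbrev SimInput (n nb K m l : ℕ) : Ty :=
  .prod (.prod (.tape (simLength nb K)) (.start n K m l)) (.prod .fld (.pow .fld K))

variable (n nb K m l) in
/-- The random tape of the simulator. -/
def tape : Circ (SimInput n nb K m l) (.tape (simLength nb K)) := (Circ.fst _ _).left

variable (n nb K m l) in
/-- The start of the view. -/
def start : Circ (SimInput n nb K m l) (.start n K m l) := (Circ.fst _ _).right

variable (n nb K m l) in
/-- The second generator `h`. -/
def secondGen : Circ (SimInput n nb K m l) .grp := (start n nb K m l).right.right.left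

/-- The client commitment `c_{i,k}`. -/
def clientComCirc (k : Fin K) (i : Fin n) : Circ (SimInput n nb K m l) .grp :=
  (start n nb K m l).right.right.right.right.left.entry₂ k i

/-- Whether client `i` is valid. -/
def validCirc (i : Fin n) : Circ (SimInput n nb K m l) .bit :=
  (start n nb K m l).right.right.right.right.right.entry i

/-- The public coin `b_{j,k}`. -/
noncomputable def publicCoin (k : Fin K) (j : Fin nb) : Circ (SimInput n nb K m l) .bit :=
  (tape n nb K m l).coinBit (k, j)

/-- The randomness of the commitment to a flipped bit. -/
noncomputable def flippedRand (k : Fin K) (j : Fin nb) : Circ (SimInput n nb K m l) .fld :=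
  (tape n nb K m l).coinFld (.inl (k, j))

/-- The uniform first component of a final message. -/
noncomputable def uniformValue (k : Fin K) : Circ (SimInput n nb K m l) .fld :=
  (tape n nb K m l).coinFld (.inr k)

variable (A : VerifierAttack n nb K m l) (I : Finset (Fin K)) (k₀ : Fin K)

/-- A circuit for `simValue`. -/
noncomputable def valueCirc (k : Fin K) : Circ (SimInput n nb K m l) .fld :=
  if k ∈ I then .fconst _ 0
  else if k = k₀ then
    ((Circ.snd _ _).left.sub (.sumWhere (fun k' => .bconst _ (decide (k' ∈ I)))
      fun k' => (Circ.snd _ _).right.entry k')).sub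
        (.sumWhere (fun k' => .bconst _ (decide (k' ∈ (insert k₀ I)ᶜ))) uniformValue)
  else uniformValue k

/-- A circuit for `simFlippedCom`. -/
noncomputable def flippedComCirc (k : Fin K) (j : Fin nb) : Circ (SimInput n nb K m l) .grp :=
  if j.val = 0 then
    ((secondGen n nb K m l).commit (valueCirc I k₀ k) (flippedRand k j)).times
      (Circ.productWhere validCirc (clientComCirc k)).ginv
  else (secondGen n nb K m l).commit (.fconst _ 0) (flippedRand k j)

/-- A circuit for `simComs`. -/
noncomputable def comsCirc : Circ (SimInput n nb K m l) (.pow (.pow .grp nb) K) :=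
  .tup fun k => .tup fun j => if k ∈ I then .one _
    else .flipCom (secondGen n nb K m l) (publicCoin k j) (flippedComCirc I k₀ k j)

/-- A circuit for `bitProofAnswers`. -/
noncomputable def answersCirc : Circ (SimInput n nb K m l) (.pow (.pow .bit nb) K) :=
  .tup fun k => .tup fun j => if k ∈ I then .bconst _ false
    else (Circ.entry₂ (.comp (.pair (start n nb K m l) (comsCirc I k₀)) A.submit) k j).eqG
      ((comsCirc I k₀).entry₂ k j)

/-- A circuit for `goesOn`. -/
noncomputable def goesOnCirc : Circ (SimInput n nb K m l) (.pow .bit K) :=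
  .comp (.pair (.pair (start n nb K m l) (comsCirc I k₀)) (answersCirc A I k₀)) A.proceed

/-- The public coins that the adversary receives. -/
noncomputable def coinsCirc : Circ (SimInput n nb K m l) (.pow (.pow .bit nb) K) :=
  .tup fun k => .tup fun j => if k ∈ I then publicCoin k j
    else ((goesOnCirc A I k₀).entry k).and (publicCoin k j)

/-- The final messages that the adversary receives. -/
noncomputable def messagesCirc : Circ (SimInput n nb K m l) (.pow (.prod .fld .fld) K) :=
  .tup fun k => if k ∈ I then .pair (.fconst _ 0) (.fconst _ 0)
    else .pair (((goesOnCirc A I k₀).entry k).mux (valueCirc I k₀ k) (.fconst _ 0))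
      (((goesOnCirc A I k₀).entry k).mux (.sum (flippedRand k)) (.fconst _ 0))

/-- The simulator for one value of the security parameter. -/
noncomputable def simulation : Simulation n nb K m l (simLength nb K) where
  input := .tup fun _ => .fconst _ 0
  output := .pair (comsCirc I k₀)
    (.pair (answersCirc A I k₀) (.pair (coinsCirc A I k₀) (messagesCirc A I k₀)))

end Circuits

section Eval

variable {n nb K m l : ℕ} {q : ℕ} [Fact q.Prime] (A : VerifierAttack n nb K m l)
  (I : Finset (Fin K)) (k₀ : Fin K) (P : PrimeGroup q) (t : Tape q (simLength nb K))
  (st : (Ty.start n K m l).El P) (y : ZMod q) (Δ : Fin K → ZMod q)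

theorem eval_valueCirc (k : Fin K) :
    (valueCirc I k₀ k : Circ (SimInput n nb K m l) .fld).eval P ((t, st), y, Δ) =
      simValue I k₀ (simOfTape t).e y Δ k := by
  rw [valueCirc, simValue]
  split_ifs
  · simp
  · simp only [Circ.eval_sub, Circ.eval_sumWhere, Circ.eval_bconst, decide_eq_true_eq,
      Finset.filter_univ_mem]
    rfl
  · rfl

theorem eval_flippedComCirc (k : Fin K) (j : Fin nb) :
    (flippedComCirc I k₀ k j : Circ (SimInput n nb K m l) .grp).eval P ((t, st), y, Δ) =
      simFlippedCom st (simValue I k₀ (simOfTape t).e y Δ k) ((simOfTape t).w k) k j := by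
  rw [flippedComCirc, simFlippedCom]
  split_ifs
  · rw [Circ.eval_times, Circ.eval_commit, eval_valueCirc, Circ.eval_ginv, Circ.eval_productWhere]
    rfl
  · rw [Circ.eval_commit, Circ.eval_fconst, Int.cast_zero]
    rfl

theorem eval_comsCirc :
    (comsCirc I k₀ : Circ (SimInput n nb K m l) _).eval P ((t, st), y, Δ) =
      simComs I st (simValue I k₀ (simOfTape t).e y Δ) (simOfTape t).b (simOfTape t).w := by
  funext k j
  rw [comsCirc, Circ.eval_tup]
  beta_reduce
  rw [Circ.eval_tup, simComs]
  beta_reduce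
  split_ifs
  · exact Circ.eval_one P _
  · rw [Circ.eval_flipCom, eval_flippedComCirc]
    rfl

theorem eval_answersCirc :
    (answersCirc A I k₀).eval P ((t, st), y, Δ) =
      bitProofAnswers P A I st
        (simComs I st (simValue I k₀ (simOfTape t).e y Δ) (simOfTape t).b (simOfTape t).w) := by
  funext k j
  rw [answersCirc, Circ.eval_tup]
  beta_reduce
  rw [Circ.eval_tup, bitProofAnswers]
  beta_reduce
  split_ifs
  · rfl
  · rw [Bool.eq_iff_iff, Circ.eval_eqG, Circ.eval_entry₂, Circ.eval_entry₂, Circ.eval_comp,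
      Circ.eval_pair, eval_comsCirc]
    exact (@decide_eq_true_iff _ (_)).symm

theorem eval_goesOnCirc :
    (goesOnCirc A I k₀).eval P ((t, st), y, Δ) =
      goesOn P A I st
        (simComs I st (simValue I k₀ (simOfTape t).e y Δ) (simOfTape t).b (simOfTape t).w) := by
  rw [goesOnCirc, Circ.eval_comp, Circ.eval_pair, Circ.eval_pair, eval_comsCirc, eval_answersCirc]
  rfl

theorem eval_coinsCirc :
    (coinsCirc A I k₀).eval P ((t, st), y, Δ) =
      (simReceived P A I k₀ st (simOfTape t) y Δ).2.2.1 := by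
  funext k j
  rw [coinsCirc, Circ.eval_tup]
  beta_reduce
  rw [Circ.eval_tup, simReceived, equivocatedView, receivedView]
  beta_reduce
  by_cases hk : k ∈ I
  · simp only [hk, if_true, true_or]
    rfl
  · rw [if_neg hk, Circ.eval_and, Circ.eval_entry, eval_goesOnCirc]
    cases hgo : goesOn P A I st
      (simComs I st (simValue I k₀ (simOfTape t).e y Δ) (simOfTape t).b (simOfTape t).w) k
    · simp [hk, hgo]
    · simp only [hgo, or_true, if_true]
      rfl

theorem eval_messagesCirc :
    (messagesCirc A I k₀).eval P ((t, st), y, Δ) =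
      (simReceived P A I k₀ st (simOfTape t) y Δ).2.2.2 := by
  funext k
  rw [messagesCirc, Circ.eval_tup, simReceived, equivocatedView, receivedView]
  beta_reduce
  by_cases hk : k ∈ I
  · simp [hk]
  · rw [if_neg hk, Circ.eval_pair, Circ.eval_mux, Circ.eval_mux, Circ.eval_entry, eval_goesOnCirc,
      eval_valueCirc, Circ.eval_sum, Circ.eval_fconst, Int.cast_zero]
    cases hgo : goesOn P A I st
      (simComs I st (simValue I k₀ (simOfTape t).e y Δ) (simOfTape t).b (simOfTape t).w) k
    · simp [hgo]
    · simp only [hk, hgo, not_false_eq_true, and_self, if_true]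
      rfl

theorem eval_simulation_output :
    (A.simulation I k₀).output.eval P ((t, st), y, Δ) =
      simReceived P A I k₀ st (simOfTape t) y Δ :=
  Prod.ext (eval_comsCirc I k₀ P t st y Δ) (Prod.ext (eval_answersCirc A I k₀ P t st y Δ)
    (Prod.ext (eval_coinsCirc A I k₀ P t st y Δ) (eval_messagesCirc A I k₀ P t st y Δ)))

end Eval

section Size

variable {ι : ℕ → Type} {n nb K m l : ℕ → ℕ}
  {A : ∀ κ, VerifierAttack (n κ) (nb κ) (K κ) (m κ) (l κ)} {I : ∀ κ, Finset (Fin (K κ))}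
  {k₀ : ∀ κ, Fin (K κ)}

theorem polySize_tape :
    PolySize fun κ (_ : ι κ) => tape (n κ) (nb κ) (K κ) (m κ) (l κ) :=
  .left (.of_size_eq_one fun _ _ => rfl)

theorem polySize_start :
    PolySize fun κ (_ : ι κ) => start (n κ) (nb κ) (K κ) (m κ) (l κ) :=
  .right (.of_size_eq_one fun _ _ => rfl)

theorem polySize_secondGen :
    PolySize fun κ (_ : ι κ) => secondGen (n κ) (nb κ) (K κ) (m κ) (l κ) :=
  polySize_start.right.right.left

theorem polySize_clientComCirc {k : ∀ κ, ι κ → Fin (K κ)} {i : ∀ κ, ι κ → Fin (n κ)} :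
    PolySize fun κ p => clientComCirc (nb := nb κ) (m := m κ) (l := l κ) (k κ p) (i κ p) :=
  polySize_start.right.right.right.right.left.entry₂

theorem polySize_validCirc {i : ∀ κ, ι κ → Fin (n κ)} :
    PolySize fun κ p => validCirc (nb := nb κ) (K := K κ) (m := m κ) (l := l κ) (i κ p) :=
  polySize_start.right.right.right.right.right.entry

theorem polySize_publicCoin {k : ∀ κ, ι κ → Fin (K κ)} {j : ∀ κ, ι κ → Fin (nb κ)} :
    PolySize fun κ p => publicCoin (n := n κ) (m := m κ) (l := l κ) (k κ p) (j κ p) :=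
  polySize_tape.coinBit

theorem polySize_flippedRand {k : ∀ κ, ι κ → Fin (K κ)} {j : ∀ κ, ι κ → Fin (nb κ)} :
    PolySize fun κ p => flippedRand (n := n κ) (m := m κ) (l := l κ) (k κ p) (j κ p) :=
  polySize_tape.coinFld

theorem polySize_uniformValue {k : ∀ κ, ι κ → Fin (K κ)} :
    PolySize fun κ p => uniformValue (n := n κ) (nb := nb κ) (m := m κ) (l := l κ) (k κ p) :=
  polySize_tape.coinFld

variable (hn : PolyBounded n) (hnb : PolyBounded nb) (hK : PolyBounded K)

include hK in
theorem polySize_valueCirc {k : ∀ κ, ι κ → Fin (K κ)} :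
    PolySize fun κ p =>
      valueCirc (n := n κ) (nb := nb κ) (m := m κ) (l := l κ) (I κ) (k₀ κ) (k κ p) :=
  have hsnd {ι : ℕ → Type} : PolySize fun κ (_ : ι κ) =>
      Circ.snd (.prod (.tape (simLength (nb κ) (K κ))) (.start (n κ) (K κ) (m κ) (l κ)))
        (.prod .fld (.pow .fld (K κ))) := .of_size_eq_one fun _ _ => rfl
  .ite (.of_size_eq_one fun _ _ => rfl) (.ite
    ((hsnd.left.sub (.sumWhere hK (.of_size_eq_one fun _ _ => rfl) hsnd.right.entry)).sub
      (.sumWhere hK (.of_size_eq_one fun _ _ => rfl) polySize_uniformValue)) polySize_uniformValue)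

include hn hK in
theorem polySize_flippedComCirc {k : ∀ κ, ι κ → Fin (K κ)} {j : ∀ κ, ι κ → Fin (nb κ)} :
    PolySize fun κ p =>
      flippedComCirc (n := n κ) (m := m κ) (l := l κ) (I κ) (k₀ κ) (k κ p) (j κ p) :=
  have hproduct : PolySize fun κ (p : ι κ) =>
      Circ.productWhere (validCirc (nb := nb κ) (K := K κ) (m := m κ) (l := l κ))
        (clientComCirc (k κ p)) :=
    .productWhere (u := fun _ _ => validCirc) hn polySize_validCirc polySize_clientComCirc
  .ite ((polySize_secondGen.commit (polySize_valueCirc hK) polySize_flippedRand).times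
      hproduct.ginv)
    (polySize_secondGen.commit (.of_size_eq_one fun _ _ => rfl) polySize_flippedRand)

include hn hnb hK

theorem polySize_comsCirc :
    PolySize fun κ (_ : ι κ) =>
      comsCirc (n := n κ) (nb := nb κ) (m := m κ) (l := l κ) (I κ) (k₀ κ) :=
  .tup hK (.tup hnb (.ite .one
    (polySize_secondGen.flipCom polySize_publicCoin (polySize_flippedComCirc hn hK))))

theorem polySize_answersCirc (hsubmit : PolyBounded fun κ => (A κ).submit.size) :
    PolySize fun κ (_ : ι κ) => answersCirc (A κ) (I κ) (k₀ κ) :=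
  .tup hK (.tup hnb (.ite (.of_size_eq_one fun _ _ => rfl)
    (((polySize_start.pair (polySize_comsCirc hn hnb hK)).comp (.of_polyBounded hsubmit)).entry₂.eqG
      (polySize_comsCirc hn hnb hK).entry₂)))

theorem polySize_goesOnCirc (hsubmit : PolyBounded fun κ => (A κ).submit.size)
    (hproceed : PolyBounded fun κ => (A κ).proceed.size) :
    PolySize fun κ (_ : ι κ) => goesOnCirc (A κ) (I κ) (k₀ κ) :=
  ((polySize_start.pair (polySize_comsCirc hn hnb hK)).pair
    (polySize_answersCirc hn hnb hK hsubmit)).comp (.of_polyBounded hproceed)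

theorem polySize_coinsCirc (hsubmit : PolyBounded fun κ => (A κ).submit.size)
    (hproceed : PolyBounded fun κ => (A κ).proceed.size) :
    PolySize fun κ (_ : ι κ) => coinsCirc (A κ) (I κ) (k₀ κ) :=
  .tup hK (.tup hnb (.ite polySize_publicCoin
    ((polySize_goesOnCirc hn hnb hK hsubmit hproceed).entry.and polySize_publicCoin)))

theorem polySize_messagesCirc (hsubmit : PolyBounded fun κ => (A κ).submit.size)
    (hproceed : PolyBounded fun κ => (A κ).proceed.size) :
    PolySize fun κ (_ : ι κ) => messagesCirc (A κ) (I κ) (k₀ κ) :=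
  have hzero {ι : ℕ → Type} : PolySize fun κ (_ : ι κ) =>
      Circ.fconst (SimInput (n κ) (nb κ) (K κ) (m κ) (l κ)) 0 := .of_size_eq_one fun _ _ => rfl
  have hgo {ι : ℕ → Type} :=
    polySize_goesOnCirc (ι := ι) (I := I) (k₀ := k₀) hn hnb hK hsubmit hproceed
  .tup hK (.ite (hzero.pair hzero) ((hgo.entry.mux (polySize_valueCirc hK) hzero).pair
    (hgo.entry.mux (.sum hnb polySize_flippedRand) hzero)))

theorem polySize_simulation_output (hsubmit : PolyBounded fun κ => (A κ).submit.size)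
    (hproceed : PolyBounded fun κ => (A κ).proceed.size) :
    PolySize fun κ (_ : ι κ) => ((A κ).simulation (I κ) (k₀ κ)).output :=
  (polySize_comsCirc hn hnb hK).pair ((polySize_answersCirc hn hnb hK hsubmit).pair
    ((polySize_coinsCirc hn hnb hK hsubmit hproceed).pair
      (polySize_messagesCirc hn hnb hK hsubmit hproceed)))

end Size

end VerifierAttack

/-- The simulator for the corrupted provers `I`; the honest prover `k₀` receives the final message
that accounts for the public output. -/
noncomputable def VerifierAdversary.simulator {N : Sizes} (A : VerifierAdversary N)
    (I : ∀ κ, Finset (Fin (N.K κ))) (k₀ : ∀ κ, Fin (N.K κ)) : Simulator A where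
  coins κ := simLength (N.nb κ) (N.K κ)
  alg κ := (A.alg κ).simulation (I κ) (k₀ κ)
  coins_poly := .simLength N.nb_poly N.K_poly
  input_poly := (PolySize.tup N.K_poly (.of_size_eq_one fun _ _ => rfl)).polyBounded
  output_poly := (VerifierAttack.polySize_simulation_output N.n_poly N.nb_poly N.K_poly
    A.submit_poly A.proceed_poly).polyBounded

/-! ### Perfect simulation -/

section Balance

variable {ι R : Type*} [Fintype ι] [DecidableEq ι] [AddCommGroup R] {I : Finset ι} {k₀ : ι}

/-- The vector of sum zero that vanishes on `I` and agrees with `d` outside of `I ∪ {k₀}`. -/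
def balancedShift (I : Finset ι) (k₀ : ι) (d : ι → R) (k : ι) : R :=
  if k ∈ I then 0 else if k = k₀ then -∑ k' ∈ (insert k₀ I)ᶜ, d k' else d k

theorem balancedShift_of_mem (d : ι → R) {k : ι} (hk : k ∈ I) : balancedShift I k₀ d k = 0 :=
  if_pos hk

theorem balancedShift_self (hk₀ : k₀ ∉ I) (d : ι → R) :
    balancedShift I k₀ d k₀ = -∑ k ∈ (insert k₀ I)ᶜ, d k := by
  rw [balancedShift, if_neg hk₀, if_pos rfl]

theorem balancedShift_of_mem_compl (d : ι → R) {k : ι} (hk : k ∈ (insert k₀ I)ᶜ) :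
    balancedShift I k₀ d k = d k := by
  rw [Finset.mem_compl, Finset.mem_insert, not_or] at hk
  rw [balancedShift, if_neg hk.2, if_neg hk.1]

theorem sum_eq_sum_add_add_sum_compl_insert (hk₀ : k₀ ∉ I) (f : ι → R) :
    ∑ k, f k = ∑ k ∈ I, f k + f k₀ + ∑ k ∈ (insert k₀ I)ᶜ, f k := by
  rw [← Finset.sum_add_sum_compl (insert k₀ I), Finset.sum_insert hk₀, add_comm (f k₀)]

theorem sum_balancedShift (hk₀ : k₀ ∉ I) (d : ι → R) : ∑ k, balancedShift I k₀ d k = 0 := by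
  rw [sum_eq_sum_add_add_sum_compl_insert hk₀, balancedShift_self hk₀,
    Finset.sum_eq_zero fun k hk => balancedShift_of_mem d hk,
    Finset.sum_congr rfl fun k hk => balancedShift_of_mem_compl d hk, zero_add, neg_add_cancel]

theorem balancedShift_sub_two_nsmul (d : ι → R) :
    balancedShift I k₀ (d - 2 • balancedShift I k₀ d) = -balancedShift I k₀ d := by
  have hcompl : ∀ k ∈ (insert k₀ I)ᶜ, (d - 2 • balancedShift I k₀ d) k = -d k := fun k hk => by
    rw [Pi.sub_apply, Pi.smul_apply, balancedShift_of_mem_compl d hk, two_nsmul,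
      sub_add_cancel_left]
  funext k
  rw [Pi.neg_apply]
  by_cases hkI : k ∈ I
  · rw [balancedShift_of_mem _ hkI, balancedShift_of_mem _ hkI, neg_zero]
  obtain rfl | hk := eq_or_ne k k₀
  · rw [balancedShift_self hkI, balancedShift_self hkI, Finset.sum_congr rfl hcompl,
      Finset.sum_neg_distrib]
  · have hmem : k ∈ (insert k₀ I)ᶜ := by simp [hk, hkI]
    rw [balancedShift_of_mem_compl _ hmem, balancedShift_of_mem_compl _ hmem, hcompl k hmem]

theorem balancedShift_eq_zero (h : ∀ k ∉ I, k = k₀) (d : ι → R) : balancedShift I k₀ d = 0 := by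
  have hempty : (insert k₀ I)ᶜ = ∅ := by
    simpa only [Finset.compl_eq_empty_iff, Finset.eq_univ_iff_forall, Finset.mem_insert,
      or_iff_not_imp_right] using h
  funext k
  rw [balancedShift, hempty, Finset.sum_empty, neg_zero]
  split_ifs with hkI hk
  · rfl
  · rfl
  · exact absurd (h k hkI) hk

end Balance

section Shares

variable {q n K : ℕ}

theorem sum_additiveShares (hK : 0 < K) (x : Fin n → ZMod q) (t : Fin K → Fin n → ZMod q)
    (i : Fin n) : ∑ k, additiveShares x t k i = x i := by
  obtain ⟨K, rfl⟩ := Nat.exists_eq_succ_of_ne_zero hK.ne'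
  simp [additiveShares, Finset.sum_filter, Fin.sum_univ_succ]

theorem additiveShares_add (x : Fin n → ZMod q) (t : Fin K → Fin n → ZMod q)
    {d : Fin K → Fin n → ZMod q} (hd : ∀ i, ∑ k, d k i = 0) :
    additiveShares x (t + d) = additiveShares x t + d := by
  funext k i
  obtain ⟨K, rfl⟩ := Nat.exists_eq_succ_of_ne_zero k.pos.ne'
  have hdi := hd i
  rw [Fin.sum_univ_succ] at hdi
  by_cases hk : k.val = 0
  · obtain rfl : k = 0 := Fin.ext hk
    simp only [additiveShares, Pi.add_apply, Finset.sum_filter, Fin.sum_univ_succ,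
      Finset.sum_add_distrib, Fin.val_zero, Fin.val_succ, ne_eq, not_true_eq_false, if_false,
      if_true, Nat.succ_ne_zero, not_false_eq_true]
    linear_combination -hdi
  · simp only [additiveShares, Pi.add_apply, if_neg hk]

end Shares

section Exchange

variable {q n nb K : ℕ} {I : Finset (Fin K)} {k₀ : Fin K} {x ind : Fin n → ZMod q}
  {u : Fin K → Fin nb → Bool}

/-- The first component of the final message of a prover with shares `sh` and noise bits `u`. -/
def partialCount (x : Fin n → ZMod q) (sh : Fin K → Fin n → ZMod q) (u : Fin K → Fin nb → Bool)
    (k : Fin K) : ZMod q :=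
  ∑ i ∈ legal x, sh k i + ∑ j, bitVal (u k j)

/-- The shift of the partial counts that replaces them by the values `te.2` for honest provers other
than `k₀`, and preserves their sum. The shares are given by the randomness `te.1`. -/
def countShift (I : Finset (Fin K)) (k₀ : Fin K) (x : Fin n → ZMod q) (u : Fin K → Fin nb → Bool)
    (te : (Fin K → Fin n → ZMod q) × (Fin K → ZMod q)) : Fin K → ZMod q :=
  balancedShift I k₀ (te.2 - partialCount x (additiveShares x te.1) u)

/-- The exchange of the values `te.2` with partial counts. The shift of the partial counts is
distributed to the clients by the weights `ind`. -/
def exchange (I : Finset (Fin K)) (k₀ : Fin K) (x ind : Fin n → ZMod q)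
    (u : Fin K → Fin nb → Bool) (te : (Fin K → Fin n → ZMod q) × (Fin K → ZMod q)) :
    (Fin K → Fin n → ZMod q) × (Fin K → ZMod q) :=
  (te.1 + fun k i => ind i * countShift I k₀ x u te k, te.2 - countShift I k₀ x u te)

theorem sum_mul_countShift (hk₀ : k₀ ∉ I) (te : (Fin K → Fin n → ZMod q) × (Fin K → ZMod q))
    (i : Fin n) : ∑ k, ind i * countShift I k₀ x u te k = 0 := by
  rw [← Finset.mul_sum, countShift, sum_balancedShift hk₀, mul_zero]

theorem additiveShares_exchange (hk₀ : k₀ ∉ I)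
    (te : (Fin K → Fin n → ZMod q) × (Fin K → ZMod q)) :
    additiveShares x (exchange I k₀ x ind u te).1 =
      additiveShares x te.1 + fun k i => ind i * countShift I k₀ x u te k :=
  additiveShares_add x te.1 (sum_mul_countShift hk₀ te)

variable (hk₀ : k₀ ∉ I) (hind : ∑ i ∈ legal x, ind i = 1 ∨ ∀ k ∉ I, k = k₀)
include hk₀ hind

theorem partialCount_exchange (te : (Fin K → Fin n → ZMod q) × (Fin K → ZMod q)) :
    partialCount x (additiveShares x (exchange I k₀ x ind u te).1) u =
      partialCount x (additiveShares x te.1) u + countShift I k₀ x u te := by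
  have hshift (k : Fin K) :
      (∑ i ∈ legal x, ind i) * countShift I k₀ x u te k = countShift I k₀ x u te k := by
    rcases hind with h | h
    · rw [h, one_mul]
    · rw [countShift, balancedShift_eq_zero h, Pi.zero_apply, mul_zero]
  funext k
  simp only [partialCount, additiveShares_exchange hk₀, Pi.add_apply, Finset.sum_add_distrib,
    ← Finset.sum_mul, hshift]
  ring

theorem exchange_involutive : Function.Involutive (exchange I k₀ x ind u) := by
  intro te
  have hshift : countShift I k₀ x u (exchange I k₀ x ind u te) = -countShift I k₀ x u te := by
    have hsub (T δ : Fin K → ZMod q) : te.2 - δ - (T + δ) = te.2 - T - 2 • δ := by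
      rw [two_nsmul]
      abel
    rw [countShift, partialCount_exchange hk₀ hind]
    exact (congrArg _ (hsub _ _)).trans (balancedShift_sub_two_nsmul _)
  refine Prod.ext ?_ ?_
  · funext k i
    rw [exchange, hshift]
    simp [exchange]
  · rw [exchange, hshift]
    simp [exchange]

end Exchange

section Value

variable {q n nb K : ℕ} (I : Finset (Fin K)) (k₀ : Fin K) (x : Fin n → ZMod q)
  (u : Fin K → Fin nb → Bool) (te : (Fin K → Fin n → ZMod q) × (Fin K → ZMod q))

/-- The public output of `M_Bin` on the inputs `0` of the corrupted provers, if the honest provers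
have the shares `sh` and the noise bits are `u`. -/
def idealOutput (sh : Fin K → Fin n → ZMod q) : ZMod q :=
  ∑ k, ((if k ∈ I then 0 else ∑ i ∈ legal x, sh k i) + ∑ j, bitVal (u k j))

/-- The simulated first components of the final messages, for the shares that are given by the
randomness `te.1`, noise bits `u`, and the uniform values `te.2` of the simulator. -/
def idealValue : Fin K → ZMod q :=
  simValue I k₀ te.2 (idealOutput I x u (additiveShares x te.1))
    fun k => if k ∈ I then ∑ j, bitVal (u k j) else 0

theorem idealOutput_eq {k₀ : Fin K} (hk₀ : k₀ ∉ I) (sh : Fin K → Fin n → ZMod q) :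
    idealOutput I x u sh = ∑ k ∈ I, ∑ j, bitVal (u k j) + partialCount x sh u k₀ +
      ∑ k ∈ (insert k₀ I)ᶜ, partialCount x sh u k := by
  rw [idealOutput, sum_eq_sum_add_add_sum_compl_insert hk₀, if_neg hk₀, partialCount]
  refine congrArg₂ _ (congrArg₂ _ (Finset.sum_congr rfl fun k hk => ?_) rfl)
    (Finset.sum_congr rfl fun k hk => ?_)
  · rw [if_pos hk, zero_add]
  · rw [Finset.mem_compl, Finset.mem_insert, not_or] at hk
    rw [if_neg hk.2, partialCount]

theorem idealValue_eq {I : Finset (Fin K)} {k₀ : Fin K} {k : Fin K} (hk : k ∉ I) :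
    idealValue I k₀ x u te k =
      partialCount x (additiveShares x te.1) u k + countShift I k₀ x u te k := by
  rw [idealValue, simValue, if_neg hk]
  split_ifs with hkk
  · subst hkk
    rw [countShift, balancedShift_self hk, idealOutput_eq I x u hk]
    simp only [Pi.sub_apply, Finset.sum_sub_distrib]
    ring
  · rw [countShift, balancedShift_of_mem_compl _ (by simp [hk, hkk]), Pi.sub_apply,
      add_sub_cancel]

end Value

section Views

variable {q : ℕ} (P : PrimeGroup q) {n nb K m l : ℕ} (A : VerifierAttack n nb K m l)
  (I : Finset (Fin K)) (aux : Fin l → Bool) (x : Fin n → ZMod q)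

theorem bitProofAnswers_honestComs (h : P.carrier) (start : (Ty.start n K m l).El P)
    (v : Fin K → Fin nb → Bool) (s : Fin K → Fin nb → ZMod q) (k : Fin K) (j : Fin nb) :
    bitProofAnswers P A I start (honestComs P h I v s) k j =
      if k ∈ I then false
      else orOracle P h (A.submit.eval P (start, honestComs P h I v s) k j)
        (bitVal (v k j)) (s k j) := by
  rw [bitProofAnswers]
  split_ifs with hk
  · rfl
  · have hcom : honestComs P h I v s k j = com P h (bitVal (v k j)) (s k j) := if_neg hk
    rw [Bool.eq_iff_iff, orOracle_eq_true, and_iff_right (bitVal_eq_zero_or_one _), hcom]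
    exact @decide_eq_true_iff _ (_)

theorem realJoint_eq (h : P.carrier) (sh : Fin K → Fin n → ZMod q) (w : ExecRand q n nb K m) :
    realJoint P h A I aux x sh w =
      ((startView P h I aux x sh w.2.r w.1,
        receivedView P A I (startView P h I aux x sh w.2.r w.1) (honestComs P h I w.2.v w.2.s)
          w.2.b (honestResponse P h x sh w.2)),
        fun k => if k ∈ I then 0 else ∑ j, bitVal (xor (w.2.v k j) (w.2.b k j))) := by
  have hanswers := funext fun k => funext fun j =>
    bitProofAnswers_honestComs P A I h (startView P h I aux x sh w.2.r w.1) w.2.v w.2.s k j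
  simp only [receivedView, goesOn, hanswers]
  rfl

theorem receivedView_congr (start : (Ty.start n K m l).El P) (c' : Fin K → Fin nb → P.carrier)
    (b : Fin K → Fin nb → Bool) {resp resp' : Fin K → ZMod q × ZMod q}
    (h : ∀ k ∉ I, resp k = resp' k) :
    receivedView P A I start c' b resp = receivedView P A I start c' b resp' := by
  simp only [receivedView]
  congr! 4 with k
  exact ite_congr rfl (fun hk => h k hk.1) fun _ => rfl

theorem equivocatedView_congr (start : (Ty.start n K m l).El P) {Y Y' : Fin K → ZMod q}
    (b : Fin K → Fin nb → Bool) (w : Fin K → Fin nb → ZMod q) (h : ∀ k ∉ I, Y k = Y' k) :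
    equivocatedView P A I start Y b w = equivocatedView P A I start Y' b w := by
  have hcoms : simComs I start Y b w = simComs I start Y' b w := by
    funext k j
    exact ite_congr rfl (fun _ => rfl) fun hk => by rw [h k hk]
  rw [equivocatedView, equivocatedView, hcoms]
  exact receivedView_congr P A I start _ b fun k hk => by rw [h k hk]

end Views

section Equivocation

variable {q : ℕ} [Fact q.Prime] {P : PrimeGroup q} {n nb K m l : ℕ} {a : ZMod q}

/-- The value to which the simulated commitment to a flipped bit is a commitment with the randomness
of the simulator, if the trapdoor is `a`, and the client commitments have openings `(sh i, r i)`. -/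
def flippedValue (a : ZMod q) (L : Finset (Fin n)) (sh r : Fin n → ZMod q) (Y : ZMod q)
    (j : Fin nb) : ZMod q :=
  if j.val = 0 then Y - ∑ i ∈ L, (sh i + a * r i) else 0

theorem sum_flippedValue (hnb : 1 ≤ nb) (L : Finset (Fin n)) (sh r : Fin n → ZMod q)
    (Y : ZMod q) :
    ∑ j : Fin nb, flippedValue a L sh r Y j = Y - ∑ i ∈ L, (sh i + a * r i) := by
  obtain ⟨nb, rfl⟩ := Nat.exists_eq_succ_of_ne_zero (Nat.one_le_iff_ne_zero.mp hnb)
  simp [flippedValue]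

theorem simFlippedCom_startView {x : Fin n → ZMod q} {sh : Fin K → Fin n → ZMod q}
    (hsh : ∀ i, ∑ k, sh k i = x i) (I : Finset (Fin K)) (aux : Fin l → Bool)
    (r : Fin K → Fin n → ZMod q) (ρ : Tape q m) (Y : ZMod q) (w : Fin nb → ZMod q) (k : Fin K)
    (j : Fin nb) :
    simFlippedCom (startView P (P.exp a) I aux x sh r ρ) Y w k j =
      com P (P.exp a) (flippedValue a (legal x) (sh k) (r k) Y j) (w j) := by
  have hprod : ∏ i with valid P (P.exp a) x sh r i = true, clientCom P (P.exp a) sh r k i =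
      com P (P.exp a) (∑ i ∈ legal x, sh k i) (∑ i ∈ legal x, r k i) := by
    rw [filter_valid_eq_legal hsh, com_sum]
    rfl
  rw [simFlippedCom, flippedValue]
  split_ifs
  · refine (congrArg (com P (P.exp a) Y (w j) * ·⁻¹) hprod).trans ?_
    rw [← com_neg, ← com_add, com_exp_inj, Finset.sum_add_distrib, ← Finset.mul_sum]
    ring
  · rfl

/-- Randomness with which the simulated commitments to the flipped bits open to the bits `u`. -/
def equivocatedRand (a : ZMod q) (L : Finset (Fin n)) (sh r : Fin n → ZMod q) (Y : ZMod q)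
    (u : Fin nb → Bool) (w : Fin nb → ZMod q) (j : Fin nb) : ZMod q :=
  w j - a⁻¹ * (bitVal (u j) - flippedValue a L sh r Y j)

theorem com_equivocatedRand (ha : a ≠ 0) (L : Finset (Fin n)) (sh r : Fin n → ZMod q) (Y : ZMod q)
    (u : Fin nb → Bool) (w : Fin nb → ZMod q) (j : Fin nb) :
    com P (P.exp a) (bitVal (u j)) (equivocatedRand a L sh r Y u w j) =
      com P (P.exp a) (flippedValue a L sh r Y j) (w j) := by
  rw [equivocatedRand, ← com_equivocate ha (flippedValue a L sh r Y j) (w j)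
    (bitVal (u j) - flippedValue a L sh r Y j), add_sub_cancel]

omit [Fact q.Prime] in
theorem flipBit_flipBit (b : Bool) (v : ZMod q) : flipBit b (flipBit b v) = v := by
  cases b <;> simp [flipBit]

omit [Fact q.Prime] in
theorem flipRand_flipRand (b : Bool) (s : ZMod q) : flipRand b (flipRand b s) = s := by
  cases b <;> simp [flipRand]

theorem aggregate_equivocatedRand (ha : a ≠ 0) (hnb : 1 ≤ nb) (L : Finset (Fin n))
    (sh r : Fin n → ZMod q) (u : Fin nb → Bool) (w : Fin nb → ZMod q) (b : Fin nb → Bool)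
    {Y : ZMod q} (hY : Y = ∑ i ∈ L, sh i + ∑ j, bitVal (u j)) :
    aggregate L sh r (fun j => bitVal (xor (u j) (b j)))
        (fun j => flipRand (b j) (equivocatedRand a L sh r Y u w j)) b = (Y, ∑ j, w j) := by
  simp only [aggregate, bitVal_xor, flipBit_flipBit, flipRand_flipRand, hY]
  refine Prod.ext rfl ?_
  simp only [equivocatedRand, Finset.sum_sub_distrib, ← Finset.mul_sum, sum_flippedValue hnb,
    Finset.sum_add_distrib]
  field_simp
  ring

/-- Turns randomness whose private bits are read as noise bits into the randomness of an execution
with these noise bits and with the simulated commitments. -/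
def equivocate (a : ZMod q) (x : Fin n → ZMod q) (sh : Fin K → Fin n → ZMod q)
    (w : ExecRand q n nb K m) : ExecRand q n nb K m :=
  (w.1, w.2.r, fun k j => xor (w.2.v k j) (w.2.b k j),
    fun k j => flipRand (w.2.b k j) (equivocatedRand a (legal x) (sh k) (w.2.r k)
      (partialCount x sh w.2.v k) (w.2.v k) (w.2.s k) j), w.2.b)

theorem equivocate_injective (a : ZMod q) (x : Fin n → ZMod q) (sh : Fin K → Fin n → ZMod q) :
    Function.Injective (equivocate (nb := nb) (m := m) a x sh) := by
  rintro ⟨ρ, r, u, w, b⟩ ⟨ρ', r', u', w', b'⟩ h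
  simp only [equivocate, Prod.mk.injEq] at h
  obtain ⟨rfl, rfl, hu, hw, rfl⟩ := h
  obtain rfl : u = u' := by
    funext k j
    exact Bool.xor_left_inj.mp (congrFun₂ hu k j)
  obtain rfl : w = w' := by
    funext k j
    have hflip := congrArg (flipRand (b k j)) (congrFun₂ hw k j)
    rw [flipRand_flipRand, flipRand_flipRand] at hflip
    exact sub_left_injective hflip
  rfl

/-- The start of the view, the simulated view for the partial counts as first components of the
final messages, and the noise of the honest provers. The noise bits stand in the place of the
private bits of `w`. -/
noncomputable def equivocatedJoint (P : PrimeGroup q) (A : VerifierAttack n nb K m l)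
    (I : Finset (Fin K)) (aux : Fin l → Bool) (x : Fin n → ZMod q) (a : ZMod q)
    (sh : Fin K → Fin n → ZMod q) (w : ExecRand q n nb K m) : (Ty.joint n nb K m l).El P :=
  let start := startView P (P.exp a) I aux x sh w.2.r w.1
  ((start, equivocatedView P A I start (partialCount x sh w.2.v) w.2.b w.2.s),
    fun k => if k ∈ I then 0 else ∑ j, bitVal (w.2.v k j))

variable (A : VerifierAttack n nb K m l) (I : Finset (Fin K)) (aux : Fin l → Bool)
  {x : Fin n → ZMod q} {sh : Fin K → Fin n → ZMod q}

theorem honestComs_equivocate (ha : a ≠ 0) (hsh : ∀ i, ∑ k, sh k i = x i)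
    (w : ExecRand q n nb K m) :
    honestComs P (P.exp a) I (equivocate a x sh w).2.v (equivocate a x sh w).2.s =
      simComs I (startView P (P.exp a) I aux x sh w.2.r w.1) (partialCount x sh w.2.v)
        w.2.b w.2.s := by
  funext k j
  refine ite_congr rfl (fun _ => rfl) fun _ => ?_
  rw [simFlippedCom_startView hsh, ← com_equivocatedRand ha _ _ _ _ (w.2.v k)]
  change _ = flipCom P (P.exp a) _ _
  rw [flipCom_com, ← bitVal_xor]
  rfl

theorem honestResponse_equivocate (ha : a ≠ 0) (hnb : 1 ≤ nb) (hsh : ∀ i, ∑ k, sh k i = x i)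
    (w : ExecRand q n nb K m) (k : Fin K) :
    honestResponse P (P.exp a) x sh (equivocate a x sh w).2 k =
      (partialCount x sh w.2.v k, ∑ j, w.2.s k j) := by
  rw [honestResponse_eq_aggregate hsh]
  exact aggregate_equivocatedRand ha hnb _ _ _ _ _ _ rfl

theorem realJoint_equivocate (ha : a ≠ 0) (hnb : 1 ≤ nb) (hsh : ∀ i, ∑ k, sh k i = x i)
    (w : ExecRand q n nb K m) :
    realJoint P (P.exp a) A I aux x sh (equivocate a x sh w) =
      equivocatedJoint P A I aux x a sh w := by
  rw [realJoint_eq, honestComs_equivocate I aux ha hsh,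
    funext (honestResponse_equivocate ha hnb hsh w)]
  refine Prod.ext rfl (funext fun k => ?_)
  simp [equivocatedJoint, equivocate, PartyRand.v, PartyRand.b]

end Equivocation

section Joint

/-- The randomness of the clients' shares, of an execution of the protocol, and the uniform values
of the simulator. -/
abbrev JointRand (q n nb K m : ℕ) : Type :=
  ((Fin K → Fin n → ZMod q) × ExecRand q n nb K m) × (Fin K → ZMod q)

/-- The exchange of the uniform values of the simulator with partial counts, where the commitments
of the clients are equivocated to the changed shares. -/
def exchangeRand {q n nb K m : ℕ} (I : Finset (Fin K)) (k₀ : Fin K) (x : Fin n → ZMod q)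
    (a : ZMod q) (ind : Fin n → ZMod q) (ω : JointRand q n nb K m) : JointRand q n nb K m :=
  let te := exchange I k₀ x ind ω.1.2.2.v (ω.1.1, ω.2)
  let shift := countShift I k₀ x ω.1.2.2.v (ω.1.1, ω.2)
  ((te.1, ω.1.2.1, fun k i => ω.1.2.2.r k i - a⁻¹ * (ind i * shift k), ω.1.2.2.2), te.2)

variable {q : ℕ} [Fact q.Prime] {P : PrimeGroup q} {n nb K m l : ℕ} {I : Finset (Fin K)}
  {k₀ : Fin K} {x ind : Fin n → ZMod q} {a : ZMod q}

theorem startView_equivocate (ha : a ≠ 0) {sh r d : Fin K → Fin n → ZMod q}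
    (hd : ∀ i, ∑ k, d k i = 0) (hdI : ∀ k ∈ I, d k = 0) (aux : Fin l → Bool) (ρ : Tape q m) :
    startView P (P.exp a) I aux x (sh + d) (fun k i => r k i - a⁻¹ * d k i) ρ =
      startView P (P.exp a) I aux x sh r ρ := by
  have hcom : clientCom P (P.exp a) (sh + d) (fun k i => r k i - a⁻¹ * d k i) =
      clientCom P (P.exp a) sh r := by
    funext k i
    exact com_equivocate ha (sh k i) (r k i) (d k i)
  have hvalid : valid P (P.exp a) x (sh + d) (fun k i => r k i - a⁻¹ * d k i) =
      valid P (P.exp a) x sh r := by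
    funext i
    rw [valid, valid, hcom, Finset.sum_sub_distrib, ← Finset.mul_sum, hd, mul_zero, sub_zero]
  have hcorrupted : (fun k i => if k ∈ I then ((sh + d) k i, r k i - a⁻¹ * d k i) else (0, 0)) =
      fun k i => if k ∈ I then (sh k i, r k i) else (0, 0) := by
    funext k i
    refine ite_congr rfl (fun hk => ?_) fun _ => rfl
    simp [hdI k hk]
  rw [startView, startView, hcom, hvalid, hcorrupted]

theorem exchangeRand_injective (hk₀ : k₀ ∉ I)
    (hind : ∑ i ∈ legal x, ind i = 1 ∨ ∀ k ∉ I, k = k₀) :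
    Function.Injective (exchangeRand (nb := nb) (m := m) I k₀ x a ind) := by
  rintro ⟨⟨t, ρ, r, u, s, b⟩, e⟩ ⟨⟨t', ρ', r', u', s', b'⟩, e'⟩ h
  simp only [exchangeRand, Prod.mk.injEq] at h
  obtain ⟨⟨ht, rfl, hr, rfl, rfl, rfl⟩, he⟩ := h
  have hte : (t, e) = (t', e') :=
    (exchange_involutive (u := u) hk₀ hind).injective (Prod.ext ht he)
  obtain ⟨rfl, rfl⟩ := Prod.mk.inj hte
  obtain rfl : r = r' := by
    funext k i
    exact sub_left_injective (congrFun₂ hr k i)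
  rfl

variable (P) in
/-- The simulated view, jointly with the noise of the honest provers. -/
noncomputable def simJoint (A : VerifierAttack n nb K m l) (I : Finset (Fin K))
    (aux : Fin l → Bool) (x : Fin n → ZMod q) (a : ZMod q) (k₀ : Fin K)
    (ω : JointRand q n nb K m) : (Ty.joint n nb K m l).El P :=
  let start := startView P (P.exp a) I aux x (additiveShares x ω.1.1) ω.1.2.2.r ω.1.2.1
  ((start, equivocatedView P A I start (idealValue I k₀ x ω.1.2.2.v (ω.1.1, ω.2)) ω.1.2.2.b
    ω.1.2.2.s), fun k => if k ∈ I then 0 else ∑ j, bitVal (ω.1.2.2.v k j))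

theorem equivocatedJoint_exchangeRand (A : VerifierAttack n nb K m l) (aux : Fin l → Bool)
    (ha : a ≠ 0) (hk₀ : k₀ ∉ I) (hind : ∑ i ∈ legal x, ind i = 1 ∨ ∀ k ∉ I, k = k₀)
    (ω : JointRand q n nb K m) :
    equivocatedJoint P A I aux x a (additiveShares x (exchangeRand I k₀ x a ind ω).1.1)
      (exchangeRand I k₀ x a ind ω).1.2 = simJoint P A I aux x a k₀ ω := by
  obtain ⟨⟨t, ρ, r, u, s, b⟩, e⟩ := ω
  have hstart := startView_equivocate (P := P) (x := x) (sh := additiveShares x t) (r := r) ha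
    (sum_mul_countShift (x := x) (ind := ind) (u := u) hk₀ (t, e))
    (fun k hk => funext fun i => by rw [countShift, balancedShift_of_mem _ hk, mul_zero]; rfl)
    aux ρ
  rw [← additiveShares_exchange (x := x) (ind := ind) (u := u) hk₀ (t, e)] at hstart
  have hcount (k : Fin K) (hk : k ∉ I) :
      partialCount x (additiveShares x (exchange I k₀ x ind u (t, e)).1) u k =
        idealValue I k₀ x u (t, e) k := by
    rw [partialCount_exchange hk₀ hind, idealValue_eq x u _ hk, Pi.add_apply]
  refine Prod.ext (Prod.ext hstart ?_) rfl
  exact (congrArg (equivocatedView P A I · _ b s) hstart).trans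
    (equivocatedView_congr P A I _ b s hcount)

set_option synthInstance.maxSize 1000 in
theorem uniform_realJoint (A : VerifierAttack n nb K m l) (aux : Fin l → Bool) (ha : a ≠ 0)
    (hnb : 1 ≤ nb) (hk₀ : k₀ ∉ I) (hx : (legal x).Nonempty ∨ ∀ k ∉ I, k = k₀) :
    ((PMF.uniformOfFintype (Fin K → Fin n → ZMod q)).bind fun t =>
      (PMF.uniformOfFintype (ExecRand q n nb K m)).map
        (realJoint P (P.exp a) A I aux x (additiveShares x t))) =
      (PMF.uniformOfFintype (JointRand q n nb K m)).map (simJoint P A I aux x a k₀) := by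
  obtain ⟨ind, hind⟩ : ∃ ind : Fin n → ZMod q,
      ∑ i ∈ legal x, ind i = 1 ∨ ∀ k ∉ I, k = k₀ := by
    rcases hx with ⟨i, hi⟩ | h
    · exact ⟨Pi.single i 1, .inl (by rw [Finset.sum_pi_single', if_pos hi])⟩
    · exact ⟨0, .inr h⟩
  have hequivocate (t : Fin K → Fin n → ZMod q) :
      (PMF.uniformOfFintype (ExecRand q n nb K m)).map
        (realJoint P (P.exp a) A I aux x (additiveShares x t)) =
      (PMF.uniformOfFintype (ExecRand q n nb K m)).map
        (equivocatedJoint P A I aux x a (additiveShares x t)) :=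
    uniform_map_congr_of_injective (equivocate_injective a x (additiveShares x t))
      (realJoint_equivocate A I aux ha hnb (sum_additiveShares k₀.pos x t))
  rw [funext hequivocate, ← uniform_map_prod fun tw : (Fin K → Fin n → ZMod q) × _ =>
      equivocatedJoint P A I aux x a (additiveShares x tw.1) tw.2,
    ← (preservesUniform_fst (β := Fin K → ZMod q)).map_comp]
  exact uniform_map_congr_of_injective (exchangeRand_injective hk₀ hind)
    (equivocatedJoint_exchangeRand A aux ha hk₀ hind)

end Joint

section Ideal

variable {q : ℕ} [Fact q.Prime] {P : PrimeGroup q} {n nb K m l : ℕ} {I : Finset (Fin K)}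
  {k₀ : Fin K}

theorem idealJoint_eq (h : P.carrier) (A : VerifierAttack n nb K m l) (aux : Fin l → Bool)
    (x : Fin n → ZMod q) (sh : Fin K → Fin n → ZMod q)
    (w : Tape q m × Tape q (simLength nb K) × (Fin K → Fin n → ZMod q)) :
    idealJoint P h (A.simulation I k₀) I aux x sh w =
      (PMF.uniformOfFintype (Fin K → Fin nb → Bool)).map fun u =>
        ((startView P h I aux x sh w.2.2 w.1,
          simReceived P A I k₀ (startView P h I aux x sh w.2.2 w.1) (simOfTape w.2.1)
            (idealOutput I x u sh) fun k => if k ∈ I then ∑ j, bitVal (u k j) else 0),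
          fun k => if k ∈ I then 0 else ∑ j, bitVal (u k j)) := by
  have hinput : (A.simulation I k₀).input.eval P (w.2.1, startView P h I aux x sh w.2.2 w.1) =
      fun _ => (0 : ZMod q) := funext fun _ => Int.cast_zero
  simp only [idealJoint, mBin_eq, PMF.map_comp, hinput]
  refine congrArg (PMF.map · _) (funext fun u => Prod.ext (Prod.ext rfl ?_) rfl)
  exact VerifierAttack.eval_simulation_output A I k₀ P w.2.1 _ _ _

/-- Collects the randomness of the ideal experiment, with the coins of the simulator decoded, in
the form in which the equivocated protocol uses it. -/
def jointRandEquiv (q n nb K m : ℕ) :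
    (Fin K → Fin n → ZMod q) × (Tape q m × SimRand q nb K × (Fin K → Fin n → ZMod q)) ×
      (Fin K → Fin nb → Bool) ≃ JointRand q n nb K m where
  toFun z := ((z.1, z.2.1.1, z.2.1.2.2, z.2.2, z.2.1.2.1.w, z.2.1.2.1.b), z.2.1.2.1.e)
  invFun ω := (ω.1.1, (ω.1.2.1, (ω.1.2.2.b, ω.1.2.2.s, ω.2), ω.1.2.2.r), ω.1.2.2.v)

set_option synthInstance.maxSize 1000 in
theorem uniform_idealJoint (A : VerifierAttack n nb K m l) (aux : Fin l → Bool)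
    (x : Fin n → ZMod q) (a : ZMod q) :
    ((PMF.uniformOfFintype (Fin K → Fin n → ZMod q)).bind fun t =>
      (PMF.uniformOfFintype
        (Tape q m × Tape q (simLength nb K) × (Fin K → Fin n → ZMod q))).bind
          (idealJoint P (P.exp a) (A.simulation I k₀) I aux x (additiveShares x t))) =
      (PMF.uniformOfFintype (JointRand q n nb K m)).map (simJoint P A I aux x a k₀) := by
  have hdecode := (preservesUniform_equiv (jointRandEquiv q n nb K m)).comp
    (preservesUniform_id.prodMap ((preservesUniform_id.prodMap
      (preservesUniform_simOfTape.prodMap preservesUniform_id)).prodMap preservesUniform_id))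
  rw [← hdecode.map_comp, uniform_map_prod]
  refine congrArg _ (funext fun t => ?_)
  rw [uniform_map_prod]
  exact congrArg _ (funext fun w => idealJoint_eq (P.exp a) A aux x _ w)

theorem realEnsemble_eq_idealEnsemble (S : GroupGen) {N : Sizes} (A : VerifierAdversary N)
    {I : ∀ κ, Finset (Fin (N.K κ))} {k₀ : ∀ κ, Fin (N.K κ)} (hk₀ : ∀ κ, k₀ κ ∉ I κ) (κ : ℕ)
    (aux : Fin (A.auxLen κ) → Bool) {x : Fin (N.n κ) → ZMod (S.q κ)}
    (hx : (legal x).Nonempty ∨ (I κ).card + 1 = N.K κ) (pp : S.PP κ) :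
    realEnsemble S A κ (I κ) aux x pp = idealEnsemble S A (A.simulator I k₀) κ (I κ) aux x pp := by
  have hhonest (hcard : (I κ).card + 1 = N.K κ) (k : Fin (N.K κ)) (hk : k ∉ I κ) : k = k₀ κ := by
    have hcompl : (I κ)ᶜ.card = 1 := by
      rw [Finset.card_compl, Fintype.card_fin]
      exact Nat.sub_eq_of_eq_add' hcard.symm
    exact Finset.card_le_one.mp hcompl.le k (Finset.mem_compl.mpr hk) _
      (Finset.mem_compl.mpr (hk₀ κ))
  rw [realEnsemble, idealEnsemble, S.h_eq_exp]
  exact (uniform_realJoint (A.alg κ) aux pp.2.ne_zero (N.nb_pos κ) (hk₀ κ)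
    (hx.imp_right hhonest)).trans (uniform_idealJoint (A.alg κ) aux x pp.2).symm

end Ideal

theorem compIndist_of_forall_eq {S : GroupGen} {τ : ℕ → Ty}
    {U V : ∀ κ (pp : S.PP κ), PMF ((τ κ).El (S.gp pp))} (h : ∀ κ pp, U κ pp = V κ pp) :
    CompIndist S τ U V := by
  obtain rfl : U = V := funext₂ h
  intro E
  simp only [sub_self, abs_zero]
  exact Asymptotics.superpolynomialDecay_zero _ _

theorem theorem1 (S : GroupGen) (N : Sizes) :
    -- completeness, with error 0, and the output is distributed as that of `M_Bin`
    (∀ (κ : ℕ) (x : Fin (N.n κ) → ZMod (S.q κ)) (sh : Fin (N.K κ) → Fin (N.n κ) → ZMod (S.q κ)),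
      (∀ i, ∑ k, sh k i = x i) →
        (honestExp S N κ x sh).map (fun o => o.accept) false = 0 ∧
        (honestExp S N κ x sh).map (fun o => o.y) =
          (mBin (N.nb κ) fun k => ∑ i ∈ legal x, sh k i).map Prod.fst) ∧
    -- computational soundness
    (∀ (A : ProverAdversary N) (I : ∀ κ, Finset (Fin (N.K κ)))
      (aux : ∀ κ, Fin (A.auxLen κ) → Bool) (x : ∀ κ, Fin (N.n κ) → ZMod (S.q κ))
      (sh : ∀ κ, Fin (N.K κ) → Fin (N.n κ) → ZMod (S.q κ)),
      (∀ κ i, ∑ k, sh κ k i = x κ i) →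
        (∀ κ, (attackExp S A κ (I κ) (aux κ) (x κ) (sh κ)).map (fun o => (o.started, o.ideal)) =
          ((attackExp S A κ (I κ) (aux κ) (x κ) (sh κ)).map fun o => o.started).bind fun st =>
            (mBin (N.nb κ) fun k => ∑ i ∈ legal (x κ), sh κ k i).map fun out => (st, out.1)) ∧
        (∃ B : DLAdversary, ∀ κ,
          cheatProb S A κ (I κ) (aux κ) (x κ) (sh κ) ≤ dlAdv S B κ) ∧
        (DLHard S →
          Negligible fun κ => (cheatProb S A κ (I κ) (aux κ) (x κ) (sh κ)).toReal)) ∧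
    -- computational zero-knowledge
    (∀ (A : VerifierAdversary N) (I : ∀ κ, Finset (Fin (N.K κ))),
      (∀ κ, I κ ⊂ Finset.univ) →
        ∃ Sim : Simulator A,
          ∀ (aux : ∀ κ, Fin (A.auxLen κ) → Bool) (x : ∀ κ, Fin (N.n κ) → ZMod (S.q κ)),
            (∀ κ, (legal (x κ)).Nonempty ∨ (I κ).card + 1 = N.K κ) →
              CompIndist S
                (fun κ => Ty.joint (N.n κ) (N.nb κ) (N.K κ) (A.coins κ) (A.auxLen κ))
                (fun κ pp => realEnsemble S A κ (I κ) (aux κ) (x κ) pp)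
                (fun κ pp => idealEnsemble S A Sim κ (I κ) (aux κ) (x κ) pp)) := by
  refine ⟨fun κ x sh hsh => ⟨honestExp_accept_false S N κ x sh, honestExp_output S N hsh⟩,
    fun A I aux x sh hsh => ⟨fun κ => attackExp_started_ideal S A (I κ) (aux κ) (hsh κ),
      ⟨A.reduction I aux x sh, cheatProb_le S A I aux hsh⟩, negligible_cheatProb S A I aux hsh⟩,
    fun A I hI => ?_⟩
  choose k₀ _ hk₀ using fun κ => Finset.exists_of_ssubset (hI κ)
  exact ⟨A.simulator I k₀, fun aux x hx => compIndist_of_forall_eq fun κ pp =>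
    realEnsemble_eq_idealEnsemble S A hk₀ κ (aux κ) (hx κ) pp⟩
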